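/- Let $\mathbb F$ be an arbitrary field, let $d\ge 1$ be an integer and let $q\in\mathbb F$ be a primitive $d$-th root of unity. Put $\hbar=d$ if $d$ is odd and $\hbar=d/2$ if $d$ is even. Let $\triangle$ (the universal Askey–Wilson algebra) be the associative unital $\mathbb F$-algebra with generators $A,B,C,\alpha,\beta,\gamma$ and the relations that each of $\alpha,\beta,\gamma$ is central and $$CB=q^2BC+q(q^2-q^{-2})A-q(q-q^{-1})\alpha,$$ $$CA=q^{-2}AC-q^{-1}(q^2-q^{-2})B+q^{-1}(q-q^{-1})\beta,$$ $$BA=q^2AB+q(q^2-q^{-2})C-q(q-q^{-1})\gamma.$$ Let $Z(\triangle)$ denote the center of $\triangle$, and let $$\Omega=q^2+q^{-2}-qABC-q^2A^2-q^{-2}B^2-q^2C^2+qA\alpha+q^{-1}B\beta+qC\gamma .$$ Let $T_n(X)$ be the normalized Chebyshev polynomials of the first kind, given by $T_0(X)=2$, $T_1(X)=X$ and $XT_n(X)=T_{n+1}(X)+T_{n-1}(X)$ for $n\ge1$. Then: 1. The elements $$T_\hbar(A)^{i_0}\,T_\hbar(B)^{i_1}\,T_\hbar(C)^{i_2}\,\alpha^{j_0}\beta^{j_1}\gamma^{j_2}\,\Omega^{\ell},\qquad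 i_0,i_1,i_2,j_0,j_1,j_2,\ell\in\mathbb N,\ \ell<\hbar,$$ (where $0\in\mathbb N$) lie in $Z(\triangle)$ and form an $\mathbb F$-basis of $Z(\triangle)$. 2. The elements $T_\hbar(A),T_\hbar(B),T_\hbar(C),\alpha,\beta,\gamma$ lie in $Z(\triangle)$, and $Z(\triangle)$ is integral over the $\mathbb F$-subalgebra of $Z(\triangle)$ that they generate. -/

import Mathlib

/-- The six generators of the universal Askey--Wilson algebra. -/
inductive UAWGen : Type
  | A | B | C | α | β | γ

open FreeAlgebra in
/-- The defining relations: `α`, `β`, `γ` commute with all generators, together with the three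
`q`-commutation relations between `A`, `B`, `C`. -/
inductive UAWRel (F : Type*) [Field F] (q : F) :
    FreeAlgebra F UAWGen → FreeAlgebra F UAWGen → Prop
  | α_central (g : UAWGen) : UAWRel F q (ι F .α * ι F g) (ι F g * ι F .α)
  | β_central (g : UAWGen) : UAWRel F q (ι F .β * ι F g) (ι F g * ι F .β)
  | γ_central (g : UAWGen) : UAWRel F q (ι F .γ * ι F g) (ι F g * ι F .γ)
  | CB : UAWRel F q (ι F .C * ι F .B)
      (q ^ 2 • (ι F .B * ι F .C) + (q * (q ^ 2 - q⁻¹ ^ 2)) • ι F .A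
        - (q * (q - q⁻¹)) • ι F .α)
  | CA : UAWRel F q (ι F .C * ι F .A)
      (q⁻¹ ^ 2 • (ι F .A * ι F .C) - (q⁻¹ * (q ^ 2 - q⁻¹ ^ 2)) • ι F .B
        + (q⁻¹ * (q - q⁻¹)) • ι F .β)
  | BA : UAWRel F q (ι F .B * ι F .A)
      (q ^ 2 • (ι F .A * ι F .B) + (q * (q ^ 2 - q⁻¹ ^ 2)) • ι F .C
        - (q * (q - q⁻¹)) • ι F .γ)

/-- The universal Askey--Wilson algebra over `F` with parameter `q`. -/
def UAW (F : Type*) [Field F] (q : F) : Type _ := RingQuot (UAWRel F q)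

noncomputable instance (F : Type*) [Field F] (q : F) : Ring (UAW F q) :=
  inferInstanceAs (Ring (RingQuot (UAWRel F q)))

noncomputable instance (F : Type*) [Field F] (q : F) : Algebra F (UAW F q) :=
  inferInstanceAs (Algebra F (RingQuot (UAWRel F q)))

namespace UAW

noncomputable section

variable (F : Type*) [Field F] (q : F)

/-- The quotient map from the free algebra. -/
def mk : FreeAlgebra F UAWGen →ₐ[F] UAW F q := RingQuot.mkAlgHom F (UAWRel F q)

/-- The image of a generator in the universal Askey--Wilson algebra. -/
def gen (g : UAWGen) : UAW F q := mk F q (FreeAlgebra.ι F g)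

def A : UAW F q := gen F q .A
def B : UAW F q := gen F q .B
def C : UAW F q := gen F q .C
def α : UAW F q := gen F q .α
def β : UAW F q := gen F q .β
def γ : UAW F q := gen F q .γ

/-- The normalized Casimir element. -/
def Ω : UAW F q :=
  algebraMap F (UAW F q) (q ^ 2 + q⁻¹ ^ 2)
    - q • (A F q * B F q * C F q)
    - q ^ 2 • A F q ^ 2 - q⁻¹ ^ 2 • B F q ^ 2 - q ^ 2 • C F q ^ 2
    + q • (A F q * α F q) + q⁻¹ • (B F q * β F q) + q • (C F q * γ F q)

/-- `T_n(x)` for the normalized Chebyshev polynomials of the first kind `T_n`, given by `T_0 = 2`,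
`T_1 = X`, `X T_n = T_{n+1} + T_{n-1}` (Mathlib's `Polynomial.Chebyshev.C`). -/
def T (n : ℕ) (x : UAW F q) : UAW F q :=
  Polynomial.aeval x (Polynomial.Chebyshev.C F (n : ℤ))

/-- The number `đ`: equal to `d` if `d` is odd and to `d / 2` if `d` is even. -/
def dbar (d : ℕ) : ℕ := if Even d then d / 2 else d

/-- The monomial `T_n(A)^{i₀} T_n(B)^{i₁} T_n(C)^{i₂} α^{j₀} β^{j₁} γ^{j₂} Ω^ℓ`. -/
def monomial (n i₀ i₁ i₂ j₀ j₁ j₂ ℓ : ℕ) : UAW F q :=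
  T F q n (A F q) ^ i₀ * T F q n (B F q) ^ i₁ * T F q n (C F q) ^ i₂
    * α F q ^ j₀ * β F q ^ j₁ * γ F q ^ j₂ * Ω F q ^ ℓ

/-- The set `{T_n(A), T_n(B), T_n(C), α, β, γ}`. -/
def sixElements (n : ℕ) : Set (UAW F q) :=
  {T F q n (A F q), T F q n (B F q), T F q n (C F q), α F q, β F q, γ F q}

/-- The `F`-subalgebra of the center generated by those central elements that belong to
`{T_n(A), T_n(B), T_n(C), α, β, γ}`. -/
def centralSubalgebra (n : ℕ) : Subalgebra F (Subalgebra.center F (UAW F q)) :=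
  Algebra.adjoin F {z | (z : UAW F q) ∈ sixElements F q n}

end

end UAW

/-! Give every generator degree one. Up to terms of lower degree, `A`, `B`, `C` commute up to powers
of q², so the ordered monomials `pbw` multiply like those of a quantum polynomial ring. They form a
basis (`pbwBasis`): spanning follows by reordering (`filt_le_span_pbw`), independence from an
explicit representation `rep` in which they send 1 to distinct monomials (`linearIndependent_pbw`).

Let ħ = `dbar d`, which is the order of q². Comparing top-degree terms of zg and gz for g = A, B
shows that the exponents i, j, k of A, B, C in a top-degree term of a central z are all congruent
modulo ħ (`modEq_of_mem_center`). Such a triple is uniquely (ħi₀ + ℓ, ħi₁ + ℓ, ħi₂ + ℓ) with ℓ < ħ.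
This is exactly the leading exponent of the proposed basis element, because T_ħ is monic of degree ħ
and Ω leads with -qABC (`hasLead_monomial`). Subtracting leading terms and descending on the degree
gives spanning; distinct leading exponents give independence. The center is then generated as a
module by the powers of Ω below ħ over the subalgebra of the six elements, hence integral over it.

It remains that the proposed elements are central. For Ω this is a computation. For T_ħ(A), moving A
leftwards past B and C is multiplication by a 2×2 matrix over F[A], corrected by β and γ. With A = u
+ u⁻¹ its eigenvalues are q²u + q⁻²u⁻¹ and q⁻²u + q²u⁻¹, and T_ħ takes both to u^ħ + u^(-ħ) because
q^(2ħ) = 1 (`commute_aeval_chebyshev`). The other two follow by the cyclic symmetry of the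
relations. -/

namespace UAW

/-! ### Generators, relations and a criterion for centrality. -/

section Relations

variable (F : Type*) [Field F] (q : F)

theorem commute_α_gen (g : UAWGen) : Commute (α F q) (gen F q g) := by
  have h := RingQuot.mkAlgHom_rel F (UAWRel.α_central (q := q) g)
  rw [map_mul, map_mul] at h
  exact h

theorem commute_β_gen (g : UAWGen) : Commute (β F q) (gen F q g) := by
  have h := RingQuot.mkAlgHom_rel F (UAWRel.β_central (q := q) g)
  rw [map_mul, map_mul] at h
  exact h

theorem commute_γ_gen (g : UAWGen) : Commute (γ F q) (gen F q g) := by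
  have h := RingQuot.mkAlgHom_rel F (UAWRel.γ_central (q := q) g)
  rw [map_mul, map_mul] at h
  exact h

theorem C_mul_B : C F q * B F q = q ^ 2 • (B F q * C F q) + (q * (q ^ 2 - q⁻¹ ^ 2)) • A F q
    - (q * (q - q⁻¹)) • α F q := by
  have h := RingQuot.mkAlgHom_rel F (UAWRel.CB (q := q))
  simp only [map_mul, map_add, map_sub, map_smul] at h
  exact h

theorem C_mul_A : C F q * A F q = q⁻¹ ^ 2 • (A F q * C F q)
    - (q⁻¹ * (q ^ 2 - q⁻¹ ^ 2)) • B F q + (q⁻¹ * (q - q⁻¹)) • β F q := by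
  have h := RingQuot.mkAlgHom_rel F (UAWRel.CA (q := q))
  simp only [map_mul, map_add, map_sub, map_smul] at h
  exact h

theorem B_mul_A : B F q * A F q = q ^ 2 • (A F q * B F q) + (q * (q ^ 2 - q⁻¹ ^ 2)) • C F q
    - (q * (q - q⁻¹)) • γ F q := by
  have h := RingQuot.mkAlgHom_rel F (UAWRel.BA (q := q))
  simp only [map_mul, map_add, map_sub, map_smul] at h
  exact h

theorem mk_surjective : Function.Surjective (mk F q) :=
  RingQuot.mkAlgHom_surjective F (UAWRel F q)

theorem adjoin_range_gen : Algebra.adjoin F (Set.range (gen F q)) = ⊤ := by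
  have h : Set.range (gen F q) = mk F q '' Set.range (FreeAlgebra.ι F) := by
    rw [← Set.range_comp]; rfl
  rw [h, ← AlgHom.map_adjoin, FreeAlgebra.adjoin_range_ι, Algebra.map_top]
  exact (AlgHom.range_eq_top _).2 (mk_surjective F q)

/-- An element commuting with all generators is central. -/
theorem mem_center_of_commute_gen {z : UAW F q} (h : ∀ g, Commute z (gen F q g)) :
    z ∈ Subalgebra.center F (UAW F q) := by
  have h1 : Algebra.adjoin F (Set.range (gen F q)) ≤ Subalgebra.centralizer F {z} := by
    rw [Algebra.adjoin_le_iff]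
    rintro _ ⟨g, rfl⟩
    rw [SetLike.mem_coe, Subalgebra.mem_centralizer_iff]
    rintro _ rfl
    exact h g
  rw [adjoin_range_gen] at h1
  rw [Subalgebra.mem_center_iff]
  intro b
  have := h1 (show b ∈ ⊤ from trivial)
  rw [Subalgebra.mem_centralizer_iff] at this
  exact (this z rfl).symm

theorem α_mem_center : α F q ∈ Subalgebra.center F (UAW F q) :=
  mem_center_of_commute_gen F q (commute_α_gen F q)

theorem β_mem_center : β F q ∈ Subalgebra.center F (UAW F q) :=
  mem_center_of_commute_gen F q (commute_β_gen F q)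

theorem γ_mem_center : γ F q ∈ Subalgebra.center F (UAW F q) :=
  mem_center_of_commute_gen F q (commute_γ_gen F q)

/-- An element commuting with `A`, `B` and `C` is central. -/
theorem mem_center_of_commute {z : UAW F q} (hA : Commute z (A F q)) (hB : Commute z (B F q))
    (hC : Commute z (C F q)) : z ∈ Subalgebra.center F (UAW F q) := by
  refine mem_center_of_commute_gen F q fun g => ?_
  cases g with
  | A => exact hA
  | B => exact hB
  | C => exact hC
  | α => exact Subalgebra.mem_center_iff.1 (α_mem_center F q) z
  | β => exact Subalgebra.mem_center_iff.1 (β_mem_center F q) z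
  | γ => exact Subalgebra.mem_center_iff.1 (γ_mem_center F q) z

end Relations

/-! ### Centrality of the Casimir element. -/

section Casimir

/-- Both sides of each commutation are brought to the normal form with α, β, γ in front and A, B, C
in order; what remains are scalar identities in q. -/
theorem casimir_commute {F K : Type*} [Field F] [Ring K] [Algebra F K] {q : F} (hq : q ≠ 0)
    {A B C α β γ : K}
    (hCB : C * B = q ^ 2 • (B * C) + (q * (q ^ 2 - q⁻¹ ^ 2)) • A - (q * (q - q⁻¹)) • α)
    (hCA : C * A = q⁻¹ ^ 2 • (A * C) - (q⁻¹ * (q ^ 2 - q⁻¹ ^ 2)) • B + (q⁻¹ * (q - q⁻¹)) • β)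
    (hBA : B * A = q ^ 2 • (A * B) + (q * (q ^ 2 - q⁻¹ ^ 2)) • C - (q * (q - q⁻¹)) • γ)
    (hα : ∀ x, x * α = α * x) (hβ : ∀ x, x * β = β * x) (hγ : ∀ x, x * γ = γ * x) {ω : K}
    (hω : ω = algebraMap F K (q ^ 2 + q⁻¹ ^ 2)
    - q • (A * B * C) - q ^ 2 • A ^ 2 - q⁻¹ ^ 2 • B ^ 2 - q ^ 2 • C ^ 2
    + q • (A * α) + q⁻¹ • (B * β) + q • (C * γ)) :
    Commute ω A ∧ Commute ω B ∧ Commute ω C := by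
  -- Products are associated to the right, so each reordering rule is also needed with a trailing
  -- factor x.
  have hCB' : ∀ x, C * (B * x) = q ^ 2 • (B * (C * x)) + (q * (q ^ 2 - q⁻¹ ^ 2)) • (A * x)
      - (q * (q - q⁻¹)) • (α * x) := fun x => by
    rw [← mul_assoc, hCB]
    simp only [add_mul, sub_mul, smul_mul_assoc, mul_assoc]
  have hCA' : ∀ x, C * (A * x) = q⁻¹ ^ 2 • (A * (C * x)) - (q⁻¹ * (q ^ 2 - q⁻¹ ^ 2)) • (B * x)
      + (q⁻¹ * (q - q⁻¹)) • (β * x) := fun x => by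
    rw [← mul_assoc, hCA]
    simp only [add_mul, sub_mul, smul_mul_assoc, mul_assoc]
  have hBA' : ∀ x, B * (A * x) = q ^ 2 • (A * (B * x)) + (q * (q ^ 2 - q⁻¹ ^ 2)) • (C * x)
      - (q * (q - q⁻¹)) • (γ * x) := fun x => by
    rw [← mul_assoc, hBA]
    simp only [add_mul, sub_mul, smul_mul_assoc, mul_assoc]
  have hα' : ∀ y x : K, y * (α * x) = α * (y * x) := fun y x => by
    rw [← mul_assoc, hα, mul_assoc]
  have hβ' : ∀ y x : K, y * (β * x) = β * (y * x) := fun y x => by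
    rw [← mul_assoc, hβ, mul_assoc]
  have hγ' : ∀ y x : K, y * (γ * x) = γ * (y * x) := fun y x => by
    rw [← mul_assoc, hγ, mul_assoc]
  have e1 : ∀ x : K, algebraMap F K (q ^ 2 + q⁻¹ ^ 2) * x = (q ^ 2 + q⁻¹ ^ 2) • x := fun x =>
    (Algebra.smul_def _ _).symm
  have e2 : ∀ x : K, x * algebraMap F K (q ^ 2 + q⁻¹ ^ 2) = (q ^ 2 + q⁻¹ ^ 2) • x := fun x => by
    rw [← Algebra.commutes, e1]
  subst hω
  refine ⟨?_, ?_, ?_⟩ <;>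
  · rw [Commute, SemiconjBy]
    simp only [hα β, hα γ, hβ γ, hα A, hα B, hα C, hβ A, hβ B, hβ C, hγ A, hγ B, hγ C,
      pow_two A, pow_two B, pow_two C, mul_assoc,
      add_mul, sub_mul, mul_add, mul_sub, smul_mul_assoc, mul_smul_comm, hCB, hCB', hCA, hCA',
      hBA, hBA', hα' A, hα' B, hα' C, hβ' A, hβ' B, hβ' C, hγ' A, hγ' B, hγ' C, e1, e2,
      smul_add, smul_sub]
    match_scalars <;> field_simp <;> ring

theorem Ω_mem_center {F : Type*} [Field F] {q : F} (hq : q ≠ 0) :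
    Ω F q ∈ Subalgebra.center F (UAW F q) := by
  have h := casimir_commute hq (C_mul_B F q) (C_mul_A F q) (B_mul_A F q)
    (Subalgebra.mem_center_iff.1 (α_mem_center F q))
    (Subalgebra.mem_center_iff.1 (β_mem_center F q))
    (Subalgebra.mem_center_iff.1 (γ_mem_center F q)) (ω := Ω F q) rfl
  exact mem_center_of_commute F q h.1 h.2.1 h.2.2

end Casimir

end UAW

namespace AskeyWilson

/-! ### Chebyshev polynomials of the matrix of right multiplication. -/

section Chebyshev

open Polynomial

/-- Moving a polynomial in `a` through a family `w` on which right multiplication by `a` is given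
by a matrix over `F[a]`. -/
theorem mul_aeval_eq_sum {F K ι : Type*} [Field F] [Ring K] [Algebra F K] [Fintype ι]
    [DecidableEq ι] (M : Matrix ι ι F[X]) (a : K) (w : ι → K)
    (h : ∀ i, w i * a = ∑ j, aeval a (M i j) * w j) (p : F[X]) (i : ι) :
    w i * aeval a p = ∑ j, aeval a ((aeval M p) i j) * w j := by
  have hX : ∀ p : F[X], (∀ i, w i * aeval a p = ∑ j, aeval a ((aeval M p) i j) * w j) →
      ∀ i, w i * aeval a (p * X) = ∑ j, aeval a ((aeval M (p * X)) i j) * w j := by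
    intro p hp i
    rw [map_mul, aeval_X, ← mul_assoc, hp, Finset.sum_mul, map_mul, aeval_X]
    simp only [mul_assoc, h, Finset.mul_sum, Matrix.mul_apply, map_sum, map_mul, Finset.sum_mul]
    rw [Finset.sum_comm]
  revert i
  induction p using Polynomial.induction_on with
  | C c =>
    intro i
    simp only [aeval_C, Matrix.algebraMap_matrix_apply]
    rw [Finset.sum_eq_single i (fun j _ hj => by simp [hj.symm]) (by simp)]
    simp [Algebra.commutes c (w i)]
  | add p r hp hr =>
    intro i
    simp [mul_add, hp, hr, add_mul, Finset.sum_add_distrib]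
  | monomial n c ih =>
    rw [pow_succ, ← mul_assoc]
    exact hX _ ih

variable {F : Type*} [Field F]

/-- The matrix of right multiplication by `A` on `B`, `C` modulo `β`, `γ`. -/
noncomputable def adMatrix (q : F) : Matrix (Fin 2) (Fin 2) F[X] :=
  !![C (q ^ 2) * X, C (q * (q ^ 2 - q⁻¹ ^ 2)); -C (q⁻¹ * (q ^ 2 - q⁻¹ ^ 2)), C (q⁻¹ ^ 2) * X]

/-- A closed form in Chebyshev polynomials of the second kind, proved through the three-term
recurrence; it avoids diagonalization and holds over every field. -/
theorem aeval_adMatrix_chebyshev {q : F} (hq : q ≠ 0) (n : ℕ) :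
    aeval (adMatrix q) (Chebyshev.C F n) =
      !![C q ^ (2 * n) * Chebyshev.S F n - C q⁻¹ ^ (2 * n) * Chebyshev.S F (n - 2),
          C q * (C q ^ (2 * n) - C q⁻¹ ^ (2 * n)) * Chebyshev.S F (n - 1);
        -(C q⁻¹ * (C q ^ (2 * n) - C q⁻¹ ^ (2 * n)) * Chebyshev.S F (n - 1)),
          C q⁻¹ ^ (2 * n) * Chebyshev.S F n - C q ^ (2 * n) * Chebyshev.S F (n - 2)] := by
  have hxy : (C q : F[X]) * C q⁻¹ = 1 := by rw [← C_mul, mul_inv_cancel₀ hq, C_1]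
  induction n using Nat.twoStepInduction with
  | zero =>
    -- The indices of `Chebyshev.S` are integers: here its values at -1 and -2, namely 0 and -1,
    -- enter.
    have e : aeval (adMatrix q) (2 : F[X]) = 1 + 1 := by
      rw [← one_add_one_eq_two (R := F[X]), map_add, map_one]
    ext i j : 1
    fin_cases i <;> fin_cases j <;> simp [e]
  | one =>
    have h : ((1 : ℤ) - 2) = -1 := by norm_num
    ext i j : 1
    fin_cases i <;> fin_cases j <;> simp [adMatrix, h, -map_inv₀]
    · exact Or.inl (by rw [← C_pow, inv_pow])
    · exact Or.inl (by rw [← C_pow, inv_pow])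
    · rw [← C_pow, inv_pow]
  | more n h0 h1 =>
    have e1 : Chebyshev.S F (n + 1) = X * Chebyshev.S F n - Chebyshev.S F (n - 1) :=
      Chebyshev.S_add_one F n
    have e2 : Chebyshev.S F (n + 2) = X * Chebyshev.S F (n + 1) - Chebyshev.S F n :=
      Chebyshev.S_add_two F n
    have e3 : Chebyshev.S F (n - 2) = X * Chebyshev.S F (n - 1) - Chebyshev.S F n :=
      Chebyshev.S_sub_two F n
    have i1 : ((n + 1 : ℕ) : ℤ) = n + 1 := by push_cast; ring
    have i2 : ((n + 2 : ℕ) : ℤ) = n + 2 := by push_cast; ring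
    have i3 : (n + 1 : ℤ) - 2 = n - 1 := by ring
    have i4 : (n + 1 : ℤ) - 1 = n := by ring
    have i5 : (n + 2 : ℤ) - 2 = n := by ring
    have i6 : (n + 2 : ℤ) - 1 = n + 1 := by ring
    rw [i1, i3, i4] at h1
    rw [i2, i5, i6, Chebyshev.C_add_two, map_sub, map_mul, aeval_X, h0, h1, adMatrix]
    rw [e2, e1, e3]
    generalize Chebyshev.S F n = s
    generalize Chebyshev.S F (n - 1) = t
    have p1 : ∀ x : F[X], x ^ (2 * (n + 1)) = x ^ (2 * n) * x ^ 2 := fun x => by ring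
    have p2 : ∀ x : F[X], x ^ (2 * (n + 2)) = x ^ (2 * n) * x ^ 4 := fun x => by ring
    simp only [p1, p2, C_mul, C_sub, C_pow]
    generalize (C q : F[X]) ^ (2 * n) = a
    generalize (C q⁻¹ : F[X]) ^ (2 * n) = b
    generalize (C q : F[X]) = x at *
    generalize (C q⁻¹ : F[X]) = y at *
    ext i j : 1
    fin_cases i <;> fin_cases j <;> simp <;> grind

theorem aeval_adMatrix_chebyshev_of_pow_eq_one {q : F} {n : ℕ} (hn : q ^ (2 * n) = 1) (h0 : q ≠ 0) :
    aeval (adMatrix q) (Chebyshev.C F n) = Matrix.scalar (Fin 2) (Chebyshev.C F n) := by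
  have h : Chebyshev.C F n = Chebyshev.S F n - Chebyshev.S F (n - 2) := by
    have := Chebyshev.C_eq_S_sub_X_mul_S F n
    rw [Chebyshev.S_sub_two, this]
    ring
  have h1 : (C q : F[X]) ^ (2 * n) = 1 := by rw [← C_pow, hn, C_1]
  have h2 : (C q⁻¹ : F[X]) ^ (2 * n) = 1 := by rw [← C_pow, inv_pow, hn, inv_one, C_1]
  rw [aeval_adMatrix_chebyshev h0, h1, h2]
  ext i j : 1
  fin_cases i <;> fin_cases j <;> simp [h]

theorem exists_aeval_fromBlocks (N P : Matrix (Fin 2) (Fin 2) F[X]) (p : F[X]) :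
    ∃ H, aeval (Matrix.fromBlocks N P 0 (Matrix.scalar (Fin 2) X)) p =
      Matrix.fromBlocks (aeval N p) H 0 (Matrix.scalar (Fin 2) p) := by
  induction p using Polynomial.induction_on with
  | C c =>
    refine ⟨0, ?_⟩
    simp only [aeval_C]
    ext (i | i) (j | j) : 1 <;> simp [Matrix.algebraMap_matrix_apply, Matrix.diagonal_apply]
  | add p r hp hr =>
    obtain ⟨H, hH⟩ := hp
    obtain ⟨K, hK⟩ := hr
    exact ⟨H + K, by rw [map_add, hH, hK, Matrix.fromBlocks_add]; simp [← Matrix.diagonal_add]⟩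
  | monomial n c ih =>
    obtain ⟨H, hH⟩ := ih
    rw [pow_succ, ← mul_assoc, map_mul, aeval_X, hH, Matrix.fromBlocks_multiply]
    exact ⟨_, by simp [-map_pow]; rfl⟩

/-- The lower blocks carry the central elements γ and β. The corner H of p(M) need not be computed:
p(M) commutes with M, and as the diagonal blocks of p(M) are scalar this forces (X - N)H = 0, where
X - N has nonzero determinant. -/
theorem aeval_fromBlocks_chebyshev {q : F} {n : ℕ} (hn : q ^ (2 * n) = 1) (h0 : q ≠ 0)
    (h2 : q ^ 2 ≠ 1) (P : Matrix (Fin 2) (Fin 2) F[X]) :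
    aeval (Matrix.fromBlocks (adMatrix q) P 0 (Matrix.scalar (Fin 2) X)) (Chebyshev.C F n) =
      Matrix.scalar _ (Chebyshev.C F n) := by
  set N := adMatrix q with hN
  set p := Chebyshev.C F n
  obtain ⟨H, hH⟩ := exists_aeval_fromBlocks N P p
  rw [aeval_adMatrix_chebyshev_of_pow_eq_one hn h0] at hH
  suffices H = 0 by
    rw [hH, this]
    ext (i | i) (j | j) : 1 <;> simp [Matrix.diagonal_apply, p]
  have hc : aeval (Matrix.fromBlocks N P 0 (Matrix.scalar (Fin 2) X)) (p * X) =
      aeval (Matrix.fromBlocks N P 0 (Matrix.scalar (Fin 2) X)) (X * p) := by rw [mul_comm]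
  rw [map_mul, map_mul, aeval_X, hH, Matrix.fromBlocks_multiply, Matrix.fromBlocks_multiply,
    Matrix.fromBlocks_inj] at hc
  have h12 := hc.2.1
  have hz : (Matrix.scalar (Fin 2) X - N) * H = 0 := by
    have e1 : Matrix.scalar (Fin 2) p * P = P * Matrix.scalar (Fin 2) p :=
      (Matrix.scalar_commute _ (Commute.all _) _).eq
    have e2 : Matrix.scalar (Fin 2) X * H = H * Matrix.scalar (Fin 2) X :=
      (Matrix.scalar_commute _ (Commute.all _) _).eq
    rw [sub_mul, e2]
    change Matrix.scalar (Fin 2) p * P + _ = _ at h12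
    rw [e1, add_comm] at h12
    exact sub_eq_zero.2 (add_right_cancel h12)
  -- The coefficient of X² is (1 - q²)(1 - q⁻²), nonzero since q² ≠ 1.
  have hdet : (Matrix.scalar (Fin 2) X - N).det ≠ 0 := by
    intro h
    have hcoeff := congrArg (fun r => coeff r 2) h
    have hd : (Matrix.scalar (Fin 2) X - N).det =
        C ((1 - q ^ 2) * (1 - q⁻¹ ^ 2)) * X ^ 2
          + C ((q * (q ^ 2 - q⁻¹ ^ 2)) * (q⁻¹ * (q ^ 2 - q⁻¹ ^ 2))) := by
      rw [Matrix.det_fin_two, hN, adMatrix]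
      simp [-map_inv₀, -map_pow, -map_mul, -map_sub]
      simp only [C_mul, C_sub, C_1]
      ring
    simp only [hd, coeff_add, coeff_C_mul, coeff_X_pow, coeff_C] at hcoeff
    have hq2 : 1 - q⁻¹ ^ 2 ≠ 0 := by
      rw [inv_pow, sub_ne_zero, ne_comm, inv_ne_one]
      exact h2
    have hq1 : 1 - q ^ 2 ≠ 0 := by rw [sub_ne_zero]; exact h2.symm
    simp [hq1] at hcoeff
    exact hq2 (by rw [inv_pow]; exact hcoeff)
  have := congrArg (fun Z => (Matrix.scalar (Fin 2) X - N).adjugate * Z) hz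
  simp only [← mul_assoc, Matrix.adjugate_mul, mul_zero, smul_mul_assoc, one_mul] at this
  exact (smul_eq_zero.1 this).resolve_left hdet

/-- If `q ^ (2 n) = 1`, the Chebyshev polynomial `T_n` of a generator commutes with the
other two generators. -/
theorem commute_aeval_chebyshev {K : Type*} [Ring K] [Algebra F K] {q : F} {n : ℕ}
    (hn : q ^ (2 * n) = 1) (h0 : q ≠ 0) (h2 : q ^ 2 ≠ 1) {a b c β γ : K}
    (hca : c * a = q⁻¹ ^ 2 • (a * c) - (q⁻¹ * (q ^ 2 - q⁻¹ ^ 2)) • b + (q⁻¹ * (q - q⁻¹)) • β)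
    (hba : b * a = q ^ 2 • (a * b) + (q * (q ^ 2 - q⁻¹ ^ 2)) • c - (q * (q - q⁻¹)) • γ)
    (hβ : Commute β a) (hγ : Commute γ a) :
    Commute (aeval a (Chebyshev.C F n)) b ∧ Commute (aeval a (Chebyshev.C F n)) c := by
  let P : Matrix (Fin 2) (Fin 2) F[X] := !![-C (q * (q - q⁻¹)), 0; 0, C (q⁻¹ * (q - q⁻¹))]
  let w : Fin 2 ⊕ Fin 2 → K := Sum.elim ![b, c] ![γ, β]
  have hw : ∀ i, w i * a = ∑ j, aeval a
      ((Matrix.fromBlocks (adMatrix q) P 0 (Matrix.scalar (Fin 2) X)) i j) * w j := by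
    rintro (i | i) <;> fin_cases i
    · simp only [w, P, adMatrix, Fintype.sum_sum_type, Fin.sum_univ_two]
      simp [-map_inv₀, -map_pow, -map_mul, -map_sub, hba, ← Algebra.smul_def]
      rw [map_mul, aeval_C, aeval_X, ← Algebra.smul_def, smul_mul_assoc]
      module
    · simp only [w, P, adMatrix, Fintype.sum_sum_type, Fin.sum_univ_two]
      simp [-map_inv₀, -map_pow, -map_mul, -map_sub, hca, ← Algebra.smul_def]
      rw [map_mul, aeval_C, aeval_X, ← Algebra.smul_def, smul_mul_assoc]
      module
    · simp [w, hγ.eq]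
    · simp [w, hβ.eq]
  have h := mul_aeval_eq_sum _ a w hw (Chebyshev.C F n)
  rw [aeval_fromBlocks_chebyshev hn h0 h2] at h
  have hb := h (Sum.inl 0)
  have hc := h (Sum.inl 1)
  simp [w, Matrix.diagonal_apply] at hb hc
  exact ⟨hb.symm, hc.symm⟩

end Chebyshev

end AskeyWilson

namespace UAW

open AskeyWilson

/-! ### The order of q² and centrality of the Chebyshev elements. -/

section TMemCenter

variable {F : Type*} [Field F] {q : F}

/-- This says that `dbar d` is the multiplicative order of q², the only way in which d enters the
argument. -/
theorem dbar_dvd_iff {d : ℕ} (hq : IsPrimitiveRoot q d) (n : ℕ) :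
    q ^ (2 * n) = 1 ↔ dbar d ∣ n := by
  rw [hq.pow_eq_one_iff_dvd, dbar]
  split_ifs with h
  · obtain ⟨e, rfl⟩ := h
    rw [← two_mul, Nat.mul_div_cancel_left e two_pos]
    exact Nat.mul_dvd_mul_iff_left two_pos
  · have : Nat.Coprime d 2 := by
      rw [Nat.coprime_comm, Nat.coprime_two_left]
      exact Nat.not_even_iff_odd.1 h
    exact this.dvd_mul_left

theorem dbar_pos {d : ℕ} (hd : 0 < d) : 0 < dbar d := by
  rw [dbar]
  split_ifs with h
  · obtain ⟨e, rfl⟩ := h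
    omega
  · exact hd

theorem T_dbar_mem_center {d : ℕ} (hd : 0 < d) (hq : IsPrimitiveRoot q d) :
    T F q (dbar d) (A F q) ∈ Subalgebra.center F (UAW F q) ∧
    T F q (dbar d) (B F q) ∈ Subalgebra.center F (UAW F q) ∧
    T F q (dbar d) (C F q) ∈ Subalgebra.center F (UAW F q) := by
  have h0 : q ≠ 0 := hq.ne_zero hd.ne'
  have hA := C_mul_A F q
  have hB := C_mul_B F q
  have hC := B_mul_A F q
  have hα := fun x => (Subalgebra.mem_center_iff.1 (α_mem_center F q) x).symm
  have hβ := fun x => (Subalgebra.mem_center_iff.1 (β_mem_center F q) x).symm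
  have hγ := fun x => (Subalgebra.mem_center_iff.1 (γ_mem_center F q) x).symm
  have hself : ∀ x : UAW F q, Commute (T F q (dbar d) x) x := fun x => by
    have h := congrArg (Polynomial.aeval x)
      (mul_comm (Polynomial.Chebyshev.C F (dbar d : ℤ)) Polynomial.X)
    rwa [map_mul, map_mul, Polynomial.aeval_X] at h
  -- If q² = 1 the determinant argument fails, but then ħ = 1, T_1(x) = x, and the relations say
  -- that A, B, C commute.
  by_cases h2 : q ^ 2 = 1
  · have h1 : dbar d = 1 := Nat.dvd_one.1 ((dbar_dvd_iff hq 1).1 (by simpa using h2))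
    have hi : q⁻¹ = q := by
      field_simp
      exact h2.symm
    simp only [hi, h2, sub_self, mul_zero, zero_smul, one_smul, add_zero, sub_zero] at hA hB hC
    have hT : ∀ x, T F q (dbar d) x = x := fun x => by
      rw [T, h1, Nat.cast_one, Polynomial.Chebyshev.C_one, Polynomial.aeval_X]
    simp only [hT]
    exact ⟨mem_center_of_commute F q rfl hC.symm hA.symm,
      mem_center_of_commute F q hC rfl hB.symm, mem_center_of_commute F q hA hB rfl⟩
  · have hn : q ^ (2 * dbar d) = 1 := (dbar_dvd_iff hq _).2 dvd_rfl
    have kA := commute_aeval_chebyshev hn h0 h2 hA hC (hβ _) (hγ _)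
    -- The relations are invariant under cyclic rotation of (A, B, C) and (α, β, γ), once they are
    -- solved for the opposite products.
    have kB := commute_aeval_chebyshev hn h0 h2 (a := B F q) (b := C F q) (c := A F q)
      (β := γ F q) (γ := α F q)
      (by rw [hC]; match_scalars <;> field_simp <;> ring) hB (hγ _) (hα _)
    have kC := commute_aeval_chebyshev hn h0 h2 (a := C F q) (b := A F q) (c := B F q)
      (β := α F q) (γ := β F q)
      (by rw [hB]; match_scalars <;> field_simp <;> ring)
      (by rw [hA]; match_scalars <;> field_simp <;> ring) (hα _) (hβ _)
    exact ⟨mem_center_of_commute F q (hself _) kA.1 kA.2,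
      mem_center_of_commute F q kB.2 (hself _) kB.1,
      mem_center_of_commute F q kC.1 kC.2 (hself _)⟩

end TMemCenter

end UAW

namespace AskeyWilson

/-! ### A representation on S[A][B], modelled on the quotient by the left ideal of C - c. -/

section Representation

open Polynomial

variable {F S : Type*} [Field F] [CommRing S] [Algebra F S] (q : F) (α β γ c : S)

/-- The matrix over `S[A]` describing how `B`, `C`, `1` move past `A`. -/
noncomputable def repMatrix : Matrix (Fin 3) (Fin 3) S[X] :=
  !![q ^ 2 • X, (q * (q ^ 2 - q⁻¹ ^ 2)) • 1, -((q * (q - q⁻¹)) • C γ);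
    -((q⁻¹ * (q ^ 2 - q⁻¹ ^ 2)) • 1), q⁻¹ ^ 2 • X, (q⁻¹ * (q - q⁻¹)) • C β;
    0, 0, X]

/-- The `(r, s)` entry of `p(repMatrix)` as a function of `p`. -/
noncomputable def repEntry (r s : Fin 3) : S[X] →ₗ[S] S[X] :=
  Matrix.entryLinearMap S S[X] r s ∘ₗ (aeval (repMatrix q β γ)).toLinearMap

theorem repEntry_apply (r s : Fin 3) (p : S[X]) :
    repEntry q β γ r s p = aeval (repMatrix q β γ) p r s := rfl

theorem repEntry_one (r s : Fin 3) : repEntry q β γ r s 1 = if r = s then 1 else 0 := by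
  rw [repEntry_apply, map_one, Matrix.one_apply]

theorem repEntry_X_mul (r s : Fin 3) (p : S[X]) :
    repEntry q β γ r s (X * p) = ∑ t, repMatrix q β γ r t * repEntry q β γ t s p := by
  simp only [repEntry_apply, map_mul, aeval_X, Matrix.mul_apply]

theorem repEntry_two (s : Fin 3) (p : S[X]) :
    repEntry q β γ 2 s p = if 2 = s then p else 0 := by
  induction p using Polynomial.induction_on with
  | C a =>
    rw [← mul_one (C a), ← smul_eq_C_mul, map_smul, repEntry_one]
    split_ifs <;> simp
  | add p r hp hr =>
    rw [map_add, hp, hr]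
    split_ifs <;> simp
  | monomial n a ih =>
    rw [pow_succ', mul_left_comm, repEntry_X_mul, Fin.sum_univ_three, ih]
    simp [repMatrix]

/-- The operators of `B` (`r = 0`), `C` (`r = 1`) and `1` (`r = 2`) on `S[A][B]`, where
`e j` is the prescribed value of `C` at `B ^ j`. -/
noncomputable def repOp (e : ℕ → S[X][X]) (r : Fin 3) : S[X][X] →ₗ[S] S[X][X] :=
  lsum fun i =>
    (LinearMap.toSpanSingleton S[X] S[X][X] (X ^ (i + 1))).restrictScalars S ∘ₗ repEntry q β γ r 0
    + (LinearMap.toSpanSingleton S[X] S[X][X] (e i)).restrictScalars S ∘ₗ repEntry q β γ r 1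
    + (LinearMap.toSpanSingleton S[X] S[X][X] (X ^ i)).restrictScalars S ∘ₗ repEntry q β γ r 2

variable (e : ℕ → S[X][X])

theorem repOp_apply (r : Fin 3) (x : S[X][X]) : repOp q β γ e r x = x.sum fun i p =>
    repEntry q β γ r 0 p • X ^ (i + 1) + repEntry q β γ r 1 p • e i
      + repEntry q β γ r 2 p • X ^ i := rfl

theorem repOp_smul_X_pow (r : Fin 3) (p : S[X]) (i : ℕ) : repOp q β γ e r (p • X ^ i) =
    repEntry q β γ r 0 p • X ^ (i + 1) + repEntry q β γ r 1 p • e i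
      + repEntry q β γ r 2 p • X ^ i := by
  rw [repOp_apply, smul_X_eq_monomial, sum_monomial_index]
  simp

theorem repOp_X_pow (r : Fin 3) (i : ℕ) : repOp q β γ e r (X ^ i) =
    if r = 0 then X ^ (i + 1) else if r = 1 then e i else X ^ i := by
  have := repOp_smul_X_pow q β γ e r 1 i
  rw [one_smul] at this
  rw [this]
  simp only [repEntry_one]
  fin_cases r <;> simp

/-- An additive property holding for all `p B ^ j` holds on `S[A][B]`. -/
theorem induction_smul_X_pow {P : S[X][X] → Prop} (hadd : ∀ x y, P x → P y → P (x + y))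
    (h : ∀ (p : S[X]) i, P (p • X ^ i)) (x : S[X][X]) : P x := by
  induction x using Polynomial.induction_on' with
  | add x y hx hy => exact hadd x y hx hy
  | monomial n p => rw [← smul_X_eq_monomial]; exact h p n

/-- Since (Xp)(M) = M · p(M), the relations for BA and CA are built into `repOp` for every choice of
`e`. Only the relation for CB constrains `e`, and it dictates the recursion `repSeq`. -/
theorem repOp_X_smul (r : Fin 3) (x : S[X][X]) :
    repOp q β γ e r ((X : S[X]) • x) = ∑ t, repMatrix q β γ r t • repOp q β γ e t x := by
  induction x using induction_smul_X_pow with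
  | hadd x y hx hy => simp only [smul_add, map_add, hx, hy, Finset.sum_add_distrib]
  | h p i =>
    rw [smul_smul, repOp_smul_X_pow]
    simp only [repOp_smul_X_pow, repEntry_X_mul, Fin.sum_univ_three]
    module

theorem repOp_two (x : S[X][X]) : repOp q β γ e 2 x = x := by
  induction x using induction_smul_X_pow with
  | hadd x y hx hy => rw [map_add, hx, hy]
  | h p i => rw [repOp_smul_X_pow]; simp [repEntry_two]

theorem repOp_zero_X_smul (x : S[X][X]) :
    repOp q β γ e 0 ((X : S[X]) • x) = q ^ 2 • ((X : S[X]) • repOp q β γ e 0 x)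
      + (q * (q ^ 2 - q⁻¹ ^ 2)) • repOp q β γ e 1 x - (q * (q - q⁻¹)) • ((C γ : S[X]) • x) := by
  rw [repOp_X_smul, Fin.sum_univ_three, repOp_two, sub_eq_add_neg]
  simp only [repMatrix, Matrix.cons_val, Matrix.of_apply, neg_smul, smul_assoc, one_smul]

theorem repOp_one_X_smul (x : S[X][X]) :
    repOp q β γ e 1 ((X : S[X]) • x) = q⁻¹ ^ 2 • ((X : S[X]) • repOp q β γ e 1 x)
      - (q⁻¹ * (q ^ 2 - q⁻¹ ^ 2)) • repOp q β γ e 0 x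
      + (q⁻¹ * (q - q⁻¹)) • ((C β : S[X]) • x) := by
  rw [repOp_X_smul, Fin.sum_univ_three, repOp_two]
  simp only [repMatrix, Matrix.cons_val, Matrix.of_apply, neg_smul, smul_assoc, one_smul]
  abel

/-- The value of `C` at `B ^ j`. -/
noncomputable def repSeq : ℕ → S[X][X]
  | 0 => C (C c)
  | j + 1 => q ^ 2 • (∑ i : Fin (j + 1),
        (repEntry q β γ 0 0 ((repSeq j).coeff i) • X ^ (i.1 + 1)
          + repEntry q β γ 0 1 ((repSeq j).coeff i) • repSeq i.1
          + repEntry q β γ 0 2 ((repSeq j).coeff i) • X ^ i.1))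
      + (q * (q ^ 2 - q⁻¹ ^ 2)) • ((X : S[X]) • X ^ j)
      - (q * (q - q⁻¹)) • ((C α : S[X]) • X ^ j)

/-- The degree in B of C·B^j is at most j, so the truncated sum in `repSeq` loses nothing and may be
replaced by `repOp` in `repSeq_succ`. -/
theorem repSeq_mem_degreeLT (j : ℕ) : repSeq q α β γ c j ∈ degreeLT S[X] (j + 1) := by
  have hX : ∀ {i j : ℕ}, i < j → (X ^ i : S[X][X]) ∈ degreeLT S[X] j := fun {i j} h => by
    rw [mem_degreeLT]
    exact (degree_X_pow_le i).trans_lt (by exact_mod_cast h)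
  have hmono : ∀ {i j : ℕ}, i ≤ j → degreeLT S[X] i ≤ degreeLT S[X] j := fun h =>
    degreeLT_mono h
  induction j using Nat.strong_induction_on with
  | _ j ih =>
    cases j with
    | zero =>
      rw [repSeq, mem_degreeLT]
      exact degree_C_le.trans_lt (by norm_num)
    | succ j =>
      rw [repSeq]
      refine sub_mem (add_mem (Submodule.smul_of_tower_mem _ _ (sum_mem fun i _ => add_mem
        (add_mem ?_ ?_) ?_)) (Submodule.smul_of_tower_mem _ _ ?_))
        (Submodule.smul_of_tower_mem _ _ ?_)
      · exact Submodule.smul_mem _ _ (hX (by omega))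
      · exact Submodule.smul_mem _ _ (hmono (by omega) (ih i.1 (by omega)))
      · exact Submodule.smul_mem _ _ (hX (by omega))
      · exact Submodule.smul_mem _ _ (hX (by omega))
      · exact Submodule.smul_mem _ _ (hX (by omega))

theorem repSeq_succ (j : ℕ) : repSeq q α β γ c (j + 1) =
    q ^ 2 • repOp q β γ (repSeq q α β γ c) 0 (repSeq q α β γ c j)
      + (q * (q ^ 2 - q⁻¹ ^ 2)) • ((X : S[X]) • X ^ j)
      - (q * (q - q⁻¹)) • ((C α : S[X]) • X ^ j) := by
  rw [repSeq, repOp_apply, sum_over_range' _ (by simp) (j + 1), Finset.sum_range]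
  have h := repSeq_mem_degreeLT q α β γ c j
  rw [mem_degreeLT] at h
  rw [degree_lt_iff_coeff_zero] at h
  exact Nat.lt_succ_of_le (natDegree_le_iff_coeff_eq_zero.2 fun N hN => h N hN)

/-- On B^i the relation is the recursion defining `repSeq`. It passes from y to A·y by the other two
relations: this is the resolution of the overlap CBA, as in the diamond lemma. -/
theorem repOp_one_repOp_zero (hq : q ≠ 0) (x : S[X][X]) :
    repOp q β γ (repSeq q α β γ c) 1 (repOp q β γ (repSeq q α β γ c) 0 x) =
      q ^ 2 • repOp q β γ (repSeq q α β γ c) 0 (repOp q β γ (repSeq q α β γ c) 1 x)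
      + (q * (q ^ 2 - q⁻¹ ^ 2)) • ((X : S[X]) • x) - (q * (q - q⁻¹)) • ((C α : S[X]) • x) := by
  have hC : ∀ (a : S) (y : S[X][X]), (C a : S[X]) • y = a • y := fun a y => by
    rw [← algebraMap_eq, algebraMap_smul]
  set B := repOp q β γ (repSeq q α β γ c) 0 with hB
  set K := repOp q β γ (repSeq q α β γ c) 1 with hK
  have hBA : ∀ y, B ((X : S[X]) • y) = _ := repOp_zero_X_smul q β γ (repSeq q α β γ c)
  have hKA : ∀ y, K ((X : S[X]) • y) = _ := repOp_one_X_smul q β γ (repSeq q α β γ c)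
  rw [← hB, ← hK] at hBA hKA
  have hX : ∀ y, K (B y) = q ^ 2 • B (K y)
      + (q * (q ^ 2 - q⁻¹ ^ 2)) • ((X : S[X]) • y) - (q * (q - q⁻¹)) • ((C α : S[X]) • y) →
      K (B ((X : S[X]) • y)) = q ^ 2 • B (K ((X : S[X]) • y))
      + (q * (q ^ 2 - q⁻¹ ^ 2)) • ((X : S[X]) • ((X : S[X]) • y))
      - (q * (q - q⁻¹)) • ((C α : S[X]) • ((X : S[X]) • y)) := by
    intro y hy
    have hα : (X : S[X]) • α • y = α • (X : S[X]) • y := smul_comm _ _ _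
    simp only [hBA, hKA, hC, map_add, map_sub, LinearMap.map_smul_of_tower, map_smul, hy]
    simp only [smul_add, smul_sub, smul_comm (X : S[X]) (_ : F) (_ : S[X][X]), hα]
    generalize (X : S[X]) • B (K y) = z1
    generalize (X : S[X]) • (X : S[X]) • y = z2
    generalize α • (X : S[X]) • y = z3
    generalize β • B y = z4
    generalize γ • K y = z5
    match_scalars <;> field_simp
  induction x using induction_smul_X_pow with
  | hadd x y hx hy =>
    simp only [map_add, hx, hy, smul_add]
    abel
  | h p i =>
    induction p using Polynomial.induction_on with
    | C a =>
      have h : K (B (X ^ i)) = q ^ 2 • B (K (X ^ i))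
          + (q * (q ^ 2 - q⁻¹ ^ 2)) • ((X : S[X]) • X ^ i)
          - (q * (q - q⁻¹)) • ((C α : S[X]) • X ^ i) := by
        rw [hB, repOp_X_pow, if_pos rfl, hK, repOp_X_pow, repOp_X_pow, if_neg one_ne_zero,
          if_pos rfl, if_neg one_ne_zero, if_pos rfl, repSeq_succ]
      rw [hC a, map_smul, map_smul, h, map_smul, map_smul]
      simp only [hC, smul_add, smul_sub, smul_comm a]
    | add p r hp hr =>
      simp only [add_smul, map_add, hp, hr, smul_add]
      abel
    | monomial n a ih =>
      rw [pow_succ', mul_left_comm, mul_smul]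
      exact hX _ ih

/-- The images of the generators in the representation of the algebra on `S[A][B]`. -/
noncomputable def repGen : UAWGen → Module.End F S[X][X]
  | .A => Algebra.lsmul F F S[X][X] (X : S[X])
  | .B => (repOp q β γ (repSeq q α β γ c) 0).restrictScalars F
  | .C => (repOp q β γ (repSeq q α β γ c) 1).restrictScalars F
  | .α => Algebra.lsmul F F S[X][X] (C α : S[X])
  | .β => Algebra.lsmul F F S[X][X] (C β : S[X])
  | .γ => Algebra.lsmul F F S[X][X] (C γ : S[X])

theorem commute_lsmul_C_repGen (s : S) (g : UAWGen) :
    Algebra.lsmul F F S[X][X] (C s : S[X]) * repGen q α β γ c g =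
      repGen q α β γ c g * Algebra.lsmul F F S[X][X] (C s : S[X]) := by
  have hC : ∀ (a : S) (y : S[X][X]), (C a : S[X]) • y = a • y := fun a y => by
    rw [← algebraMap_eq, algebraMap_smul]
  ext1 x
  cases g <;> simp only [repGen, Module.End.mul_apply, Algebra.lsmul_coe, hC,
    LinearMap.restrictScalars_apply, map_smul] <;> exact smul_comm _ _ _

/-- The representation of the universal Askey-Wilson algebra on `S[A][B]`. -/
noncomputable def rep (hq : q ≠ 0) : UAW F q →ₐ[F] Module.End F S[X][X] :=
  RingQuot.liftAlgHom F ⟨FreeAlgebra.lift F (repGen q α β γ c), fun x y h => by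
    cases h with
    | α_central g =>
      simp only [map_mul, FreeAlgebra.lift_ι_apply]
      exact commute_lsmul_C_repGen q α β γ c α g
    | β_central g =>
      simp only [map_mul, FreeAlgebra.lift_ι_apply]
      exact commute_lsmul_C_repGen q α β γ c β g
    | γ_central g =>
      simp only [map_mul, FreeAlgebra.lift_ι_apply]
      exact commute_lsmul_C_repGen q α β γ c γ g
    | CB =>
      simp only [map_mul, map_add, map_sub, map_smul, FreeAlgebra.lift_ι_apply]
      exact LinearMap.ext (repOp_one_repOp_zero q α β γ c hq)
    | CA =>
      simp only [map_mul, map_add, map_sub, map_smul, FreeAlgebra.lift_ι_apply]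
      exact LinearMap.ext (repOp_one_X_smul q β γ (repSeq q α β γ c))
    | BA =>
      simp only [map_mul, map_add, map_sub, map_smul, FreeAlgebra.lift_ι_apply]
      exact LinearMap.ext (repOp_zero_X_smul q β γ (repSeq q α β γ c))⟩

theorem rep_gen (hq : q ≠ 0) (g : UAWGen) :
    rep q α β γ c hq (UAW.gen F q g) = repGen q α β γ c g := by
  change RingQuot.liftAlgHom F _ (RingQuot.mkAlgHom F (UAWRel F q) (FreeAlgebra.ι F g)) = _
  rw [RingQuot.liftAlgHom_mkAlgHom_apply, FreeAlgebra.lift_ι_apply]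

end Representation

end AskeyWilson

/-! ### Linear independence of the ordered monomials. -/

namespace UAW

open AskeyWilson Polynomial

/-- The ordered monomial `A^i B^j C^k α^r β^s γ^t`. -/
noncomputable def pbw (F : Type*) [Field F] (q : F) (m : (ℕ × ℕ × ℕ) × (ℕ × ℕ × ℕ)) : UAW F q :=
  A F q ^ m.1.1 * B F q ^ m.1.2.1 * C F q ^ m.1.2.2
    * α F q ^ m.2.1 * β F q ^ m.2.2.1 * γ F q ^ m.2.2.2

/-- On the vector 1 the operator C^k gives the scalar c^k and B^j gives B^j, so no reordering is
ever needed. -/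
theorem rep_pbw_one {F S : Type*} [Field F] [CommRing S] [Algebra F S] {q : F} (hq : q ≠ 0)
    (a b g c : S) (m : (ℕ × ℕ × ℕ) × (ℕ × ℕ × ℕ)) :
    rep q a b g c hq (pbw F q m) 1 = Polynomial.monomial m.1.2.1 (Polynomial.monomial m.1.1
      (c ^ m.1.2.2 * a ^ m.2.1 * b ^ m.2.2.1 * g ^ m.2.2.2)) := by
  obtain ⟨⟨i, j, k⟩, r, s, t⟩ := m
  have hC : ∀ (x : S) (y : S[X][X]), (Polynomial.C x : S[X]) • y = x • y := fun x y => by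
    rw [← algebraMap_eq, algebraMap_smul]
  have hlin : ∀ (r : Fin 3) (n : ℕ) (x : S) (y : S[X][X]),
      (((repOp q b g (repSeq q a b g c) r).restrictScalars F) ^ n) (x • y) =
        x • (((repOp q b g (repSeq q a b g c) r).restrictScalars F) ^ n) y := by
    intro r n x
    induction n with
    | zero => intro y; rfl
    | succ n ih => intro y; simp only [pow_succ, Module.End.mul_apply,
        LinearMap.restrictScalars_apply, map_smul, ih]
  have hCk : ∀ k : ℕ, (((repOp q b g (repSeq q a b g c) 1).restrictScalars F) ^ k) 1 =
      c ^ k • (1 : S[X][X]) := by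
    intro k
    induction k with
    | zero => simp
    | succ n ih =>
      have h := repOp_X_pow q b g (repSeq q a b g c) 1 0
      rw [pow_zero, if_neg one_ne_zero, if_pos rfl, repSeq] at h
      rw [pow_succ', Module.End.mul_apply, ih, LinearMap.restrictScalars_apply, map_smul, h,
        pow_succ, mul_smul, Algebra.smul_def c (1 : S[X][X]), mul_one]
      rfl
  have hBj : ∀ j : ℕ, (((repOp q b g (repSeq q a b g c) 0).restrictScalars F) ^ j) 1 =
      (X ^ j : S[X][X]) := by
    intro j
    induction j with
    | zero => simp
    | succ n ih =>
      rw [pow_succ', Module.End.mul_apply, ih, LinearMap.restrictScalars_apply, repOp_X_pow,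
        if_pos rfl]
  simp only [pbw, A, B, C, α, β, γ, map_mul, map_pow, rep_gen, repGen]
  simp only [← map_pow (Algebra.lsmul F F S[X][X]), Module.End.mul_apply, Algebra.lsmul_coe]
  simp only [← C_pow, hC, hlin, hCk, hBj, smul_smul]
  rw [smul_comm, smul_X_eq_monomial, smul_monomial, smul_X_eq_monomial]
  congr 2
  ring

theorem rep_pbw_one_single {F : Type*} [Field F] {q : F} (hq : q ≠ 0)
    (m : (ℕ × ℕ × ℕ) × (ℕ × ℕ × ℕ)) :
    rep q (AddMonoidAlgebra.single ((0, 1, 0, 0) : ℕ × ℕ × ℕ × ℕ) (1 : F))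
      (AddMonoidAlgebra.single (0, 0, 1, 0) 1) (AddMonoidAlgebra.single (0, 0, 0, 1) 1)
      (AddMonoidAlgebra.single (1, 0, 0, 0) 1) hq (pbw F q m) 1 =
    Polynomial.monomial m.1.2.1 (Polynomial.monomial m.1.1
      (AddMonoidAlgebra.single (m.1.2.2, m.2) 1)) := by
  rw [rep_pbw_one]
  simp [AddMonoidAlgebra.single_pow, AddMonoidAlgebra.single_mul_single]

theorem linearIndependent_pbw {F : Type*} [Field F] {q : F} (hq : q ≠ 0) :
    LinearIndependent F (pbw F q) := by
  rw [linearIndependent_iff']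
  intro s g hg m hm
  -- S is the polynomial ring in four variables c, α, β, γ, written as a monoid algebra on ℕ⁴;
  -- distinct exponents then give distinct monomials.
  have h := congrArg (fun z => rep q
    (AddMonoidAlgebra.single ((0, 1, 0, 0) : ℕ × ℕ × ℕ × ℕ) (1 : F))
      (AddMonoidAlgebra.single (0, 0, 1, 0) 1) (AddMonoidAlgebra.single (0, 0, 0, 1) 1)
      (AddMonoidAlgebra.single (1, 0, 0, 0) 1) hq z 1) hg
  simp only [map_sum, map_smul, LinearMap.sum_apply, LinearMap.smul_apply, rep_pbw_one_single,
    map_zero, LinearMap.zero_apply] at h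
  replace h := congrArg (fun y => ((y.coeff m.1.2.1).coeff m.1.1).coeff (m.1.2.2, m.2)) h
  simp only [finsetSum_coeff, coeff_smul, AddMonoidAlgebra.coeff_sum, Finsupp.finsetSum_apply,
    AddMonoidAlgebra.coeff_smul, Finsupp.smul_apply, coeff_monomial] at h
  rw [Finset.sum_eq_single m] at h
  · simpa using h
  · intro m' _ hne
    split_ifs with h1
    · rw [coeff_monomial]
      split_ifs with h2
      · rw [AddMonoidAlgebra.coeff_single, Finsupp.single_apply, if_neg, smul_zero]
        intro h3
        rw [Prod.mk.injEq] at h3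
        exact hne (Prod.ext (Prod.ext h2 (Prod.ext h1 h3.1)) h3.2)
      · simp
    · simp
  · exact fun h => absurd hm h

end UAW

namespace UAW

/-! ### The degree filtration, commutation up to lower terms, and the basis of ordered monomials. -/

section Filtration

variable (F : Type*) [Field F] (q : F)

/-- The degree filtration in which all generators have degree one. -/
noncomputable def filt (n : ℕ) : Submodule F (UAW F q) :=
  Submodule.span F (insert 1 (Set.range (gen F q))) ^ n

/-- The elements of degree less than `n`. -/
noncomputable def filtLT : ℕ → Submodule F (UAW F q)
  | 0 => ⊥
  | n + 1 => filt F q n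

variable {F q}

theorem mul_mem_filt {m n : ℕ} {x y : UAW F q} (hx : x ∈ filt F q m) (hy : y ∈ filt F q n) :
    x * y ∈ filt F q (m + n) := by
  rw [filt, pow_add]
  exact Submodule.mul_mem_mul hx hy

theorem one_mem_filt_zero : (1 : UAW F q) ∈ filt F q 0 := by
  rw [filt, pow_zero]
  exact Submodule.one_le.1 le_rfl

theorem one_mem_filt_one : (1 : UAW F q) ∈ filt F q 1 := by
  rw [filt, pow_one]
  exact Submodule.subset_span (Set.mem_insert _ _)

theorem gen_mem_filt (g : UAWGen) : gen F q g ∈ filt F q 1 := by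
  rw [filt, pow_one]
  exact Submodule.subset_span (Set.mem_insert_of_mem _ ⟨g, rfl⟩)

theorem filt_mono {m n : ℕ} (h : m ≤ n) : filt F q m ≤ filt F q n := by
  induction h with
  | refl => exact le_rfl
  | step _ ih => exact ih.trans fun x hx => by simpa using mul_mem_filt hx one_mem_filt_one

theorem filtLT_le (n : ℕ) : filtLT F q n ≤ filt F q n := by
  cases n with
  | zero => exact bot_le
  | succ n => exact filt_mono n.le_succ

theorem filt_le_filtLT {m n : ℕ} (h : m < n) : filt F q m ≤ filtLT F q n := by
  cases n with
  | zero => omega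
  | succ n => exact filt_mono (Nat.le_of_lt_succ h)

theorem mul_mem_filtLT_left {m n : ℕ} {x y : UAW F q} (hx : x ∈ filtLT F q m)
    (hy : y ∈ filt F q n) : x * y ∈ filtLT F q (m + n) := by
  cases m with
  | zero =>
    rw [filtLT, Submodule.mem_bot] at hx
    rw [hx, zero_mul]
    exact zero_mem _
  | succ m => exact filt_le_filtLT (by omega) (mul_mem_filt hx hy)

theorem mul_mem_filtLT_right {m n : ℕ} {x y : UAW F q} (hx : x ∈ filt F q m)
    (hy : y ∈ filtLT F q n) : x * y ∈ filtLT F q (m + n) := by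
  cases n with
  | zero =>
    rw [filtLT, Submodule.mem_bot] at hy
    rw [hy, mul_zero]
    exact zero_mem _
  | succ n => exact filt_le_filtLT (by omega) (mul_mem_filt hx hy)

theorem pow_mem_filt {n : ℕ} {x : UAW F q} (hx : x ∈ filt F q n) (k : ℕ) :
    x ^ k ∈ filt F q (k * n) := by
  rw [filt, mul_comm, pow_mul]
  exact Submodule.pow_mem_pow _ hx k

/-- `x` of degree `m` and `y` of degree `n` commute up to the scalar `c` and lower terms. -/
structure QCommute (m n : ℕ) (x y : UAW F q) (c : F) : Prop where
  left_mem : x ∈ filt F q m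
  right_mem : y ∈ filt F q n
  sub_mem : x * y - c • (y * x) ∈ filtLT F q (m + n)

theorem QCommute.of_commute {m n : ℕ} {x y : UAW F q} (hx : x ∈ filt F q m)
    (hy : y ∈ filt F q n) (h : Commute x y) : QCommute m n x y 1 :=
  ⟨hx, hy, by rw [one_smul, h.eq, sub_self]; exact zero_mem _⟩

theorem QCommute.mul_left {m₁ m₂ n : ℕ} {x₁ x₂ y : UAW F q} {c₁ c₂ : F}
    (h₁ : QCommute m₁ n x₁ y c₁) (h₂ : QCommute m₂ n x₂ y c₂) :
    QCommute (m₁ + m₂) n (x₁ * x₂) y (c₁ * c₂) := by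
  refine ⟨mul_mem_filt h₁.1 h₂.1, h₁.2, ?_⟩
  have e : x₁ * x₂ * y - (c₁ * c₂) • (y * (x₁ * x₂)) =
      x₁ * (x₂ * y - c₂ • (y * x₂)) + c₂ • ((x₁ * y - c₁ • (y * x₁)) * x₂) := by
    simp only [mul_sub, sub_mul, mul_smul_comm, smul_mul_assoc, smul_sub, smul_smul, mul_assoc,
      mul_comm c₂ c₁]
    abel
  rw [e]
  refine add_mem ?_ (Submodule.smul_mem _ _ ?_)
  · rw [add_assoc]
    exact mul_mem_filtLT_right h₁.1 h₂.3
  · rw [add_right_comm]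
    exact mul_mem_filtLT_left h₁.3 h₂.1

theorem QCommute.pow_left {m n : ℕ} {x y : UAW F q} {c : F} (h : QCommute m n x y c) (k : ℕ) :
    QCommute (k * m) n (x ^ k) y (c ^ k) := by
  induction k with
  | zero =>
    simpa using QCommute.of_commute one_mem_filt_zero h.2 (Commute.one_left y)
  | succ k ih =>
    rw [pow_succ, pow_succ, Nat.succ_mul]
    exact ih.mul_left h

theorem QCommute.symm {m n : ℕ} {x y : UAW F q} {c : F} (h : QCommute m n x y c) (hc : c ≠ 0) :
    QCommute n m y x c⁻¹ := by
  refine ⟨h.2, h.1, ?_⟩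
  have e : y * x - c⁻¹ • (x * y) = (-c⁻¹) • (x * y - c • (y * x)) := by
    rw [smul_sub, smul_smul, neg_mul, inv_mul_cancel₀ hc]
    module
  rw [e, add_comm]
  exact Submodule.smul_mem _ _ h.3

theorem qCommute_C_B : QCommute 1 1 (C F q) (B F q) (q ^ 2) := by
  refine ⟨gen_mem_filt _, gen_mem_filt _, ?_⟩
  rw [C_mul_B, add_sub_assoc, add_sub_cancel_left]
  exact sub_mem (Submodule.smul_mem _ _ (gen_mem_filt _)) (Submodule.smul_mem _ _ (gen_mem_filt _))

theorem qCommute_B_A : QCommute 1 1 (B F q) (A F q) (q ^ 2) := by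
  refine ⟨gen_mem_filt _, gen_mem_filt _, ?_⟩
  rw [B_mul_A, add_sub_assoc, add_sub_cancel_left]
  exact sub_mem (Submodule.smul_mem _ _ (gen_mem_filt _)) (Submodule.smul_mem _ _ (gen_mem_filt _))

theorem qCommute_C_A : QCommute 1 1 (C F q) (A F q) (q⁻¹ ^ 2) := by
  refine ⟨gen_mem_filt _, gen_mem_filt _, ?_⟩
  rw [C_mul_A, sub_add, sub_sub_cancel_left, neg_sub]
  exact sub_mem (Submodule.smul_mem _ _ (gen_mem_filt _)) (Submodule.smul_mem _ _ (gen_mem_filt _))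

/-- The degree of an ordered monomial. -/
def deg (m : (ℕ × ℕ × ℕ) × (ℕ × ℕ × ℕ)) : ℕ :=
  m.1.1 + m.1.2.1 + m.1.2.2 + m.2.1 + m.2.2.1 + m.2.2.2

theorem deg_add (m m' : (ℕ × ℕ × ℕ) × (ℕ × ℕ × ℕ)) : deg (m + m') = deg m + deg m' := by
  simp only [deg, Prod.fst_add, Prod.snd_add]
  omega

/-- The exponent vector of a generator. -/
def single : UAWGen → (ℕ × ℕ × ℕ) × (ℕ × ℕ × ℕ)
  | .A => ((1, 0, 0), (0, 0, 0))
  | .B => ((0, 1, 0), (0, 0, 0))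
  | .C => ((0, 0, 1), (0, 0, 0))
  | .α => ((0, 0, 0), (1, 0, 0))
  | .β => ((0, 0, 0), (0, 1, 0))
  | .γ => ((0, 0, 0), (0, 0, 1))

theorem deg_single (g : UAWGen) : deg (single g) = 1 := by cases g <;> rfl

theorem commute_of_mem_center {z : UAW F q} (hz : z ∈ Subalgebra.center F (UAW F q))
    (x : UAW F q) : Commute z x :=
  (Subalgebra.mem_center_iff.1 hz x).symm

theorem gen_pow_mem_filt (g : UAWGen) (k : ℕ) : gen F q g ^ k ∈ filt F q k := by
  simpa using pow_mem_filt (gen_mem_filt (F := F) (q := q) g) k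

theorem pbw_mem_filt (m : (ℕ × ℕ × ℕ) × (ℕ × ℕ × ℕ)) : pbw F q m ∈ filt F q (deg m) :=
  mul_mem_filt (mul_mem_filt (mul_mem_filt (mul_mem_filt (mul_mem_filt (gen_pow_mem_filt _ _)
    (gen_pow_mem_filt _ _)) (gen_pow_mem_filt _ _)) (gen_pow_mem_filt _ _)) (gen_pow_mem_filt _ _))
    (gen_pow_mem_filt _ _)

/-- Right multiplication of an ordered monomial by `y`, up to lower terms, given the commutation
of `y` with `A`, `B`, `C`. -/
theorem qCommute_pbw {y : UAW F q} {a b c : F} (hA : QCommute 1 1 (A F q) y a)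
    (hB : QCommute 1 1 (B F q) y b) (hC : QCommute 1 1 (C F q) y c)
    (m : (ℕ × ℕ × ℕ) × (ℕ × ℕ × ℕ)) :
    QCommute (deg m) 1 (pbw F q m) y (a ^ m.1.1 * b ^ m.1.2.1 * c ^ m.1.2.2) := by
  have h := (((((hA.pow_left m.1.1).mul_left (hB.pow_left m.1.2.1)).mul_left
    (hC.pow_left m.1.2.2)).mul_left ((QCommute.of_commute (gen_mem_filt .α) hA.2
    (commute_of_mem_center (α_mem_center F q) y)).pow_left m.2.1)).mul_left
    ((QCommute.of_commute (gen_mem_filt .β) hA.2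
    (commute_of_mem_center (β_mem_center F q) y)).pow_left m.2.2.1)).mul_left
    ((QCommute.of_commute (gen_mem_filt .γ) hA.2
    (commute_of_mem_center (γ_mem_center F q) y)).pow_left m.2.2.2)
  simp only [mul_one, one_pow] at h
  exact h

/-- Left multiplication of an ordered monomial by a generator. -/
theorem gen_mul_pbw (hq : q ≠ 0) (g : UAWGen) (m : (ℕ × ℕ × ℕ) × (ℕ × ℕ × ℕ)) :
    ∃ c : F, c ≠ 0 ∧ gen F q g * pbw F q m - c • pbw F q (m + single g) ∈
      filtLT F q (deg m + 1) := by
  obtain ⟨⟨i, j, k⟩, r, s, t⟩ := m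
  have hα := fun x => commute_of_mem_center (α_mem_center F q) x
  have hβ := fun x => commute_of_mem_center (β_mem_center F q) x
  have hγ := fun x => commute_of_mem_center (γ_mem_center F q) x
  cases g with
  | A =>
    refine ⟨1, one_ne_zero, ?_⟩
    have e : pbw F q (((i, j, k), r, s, t) + single .A) = A F q * pbw F q ((i, j, k), r, s, t) := by
      simp only [pbw, single, Prod.mk_add_mk, add_zero, pow_succ', mul_assoc]
    rw [e, one_smul, A, sub_self]
    exact zero_mem _
  | B =>
    -- Powers are available only in the left argument of `QCommute`, hence one flip before taking
    -- the power of A and one after.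
    have h := (qCommute_B_A (F := F) (q := q)).symm (pow_ne_zero 2 hq) |>.pow_left i |>.symm
      (by simp [hq])
    refine ⟨(((q ^ 2)⁻¹) ^ i)⁻¹, by simp [hq], ?_⟩
    have h2 := mul_mem_filtLT_left h.3 (pbw_mem_filt ((0, j, k), r, s, t))
    convert h2 using 1
    · congr 1
      simp only [deg]
      omega
    · simp only [pbw, single, Prod.mk_add_mk, add_zero, pow_succ', mul_assoc, sub_mul, pow_zero,
        one_mul, smul_mul_assoc]
      rfl
  | C =>
    have h := ((qCommute_C_A (F := F) (q := q)).symm (by simp [hq]) |>.pow_left i).mul_left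
      ((qCommute_C_B (F := F) (q := q)).symm (pow_ne_zero 2 hq) |>.pow_left j) |>.symm
      (by simp [hq])
    refine ⟨(((q⁻¹ ^ 2)⁻¹) ^ i * ((q ^ 2)⁻¹) ^ j)⁻¹, by simp [hq], ?_⟩
    have h2 := mul_mem_filtLT_left h.3 (pbw_mem_filt ((0, 0, k), r, s, t))
    convert h2 using 1
    · congr 1
      simp only [deg]
      omega
    · simp only [pbw, single, Prod.mk_add_mk, add_zero, pow_succ', mul_assoc, sub_mul, pow_zero,
        one_mul, smul_mul_assoc]
      rfl
  | α =>
    refine ⟨1, one_ne_zero, ?_⟩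
    have e : pbw F q (((i, j, k), r, s, t) + single .α) = α F q * pbw F q ((i, j, k), r, s, t) := by
      simp only [pbw, single, Prod.mk_add_mk, add_zero, pow_succ, mul_assoc]
      rw [(hα (A F q ^ i)).left_comm, (hα (B F q ^ j)).left_comm, (hα (C F q ^ k)).left_comm,
        (hα (α F q ^ r)).left_comm]
    rw [e, one_smul, α, sub_self]
    exact zero_mem _
  | β =>
    refine ⟨1, one_ne_zero, ?_⟩
    have e : pbw F q (((i, j, k), r, s, t) + single .β) = β F q * pbw F q ((i, j, k), r, s, t) := by
      simp only [pbw, single, Prod.mk_add_mk, add_zero, pow_succ, mul_assoc]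
      rw [(hβ (A F q ^ i)).left_comm, (hβ (B F q ^ j)).left_comm, (hβ (C F q ^ k)).left_comm,
        (hβ (α F q ^ r)).left_comm, (hβ (β F q ^ s)).left_comm]
    rw [e, one_smul, β, sub_self]
    exact zero_mem _
  | γ =>
    refine ⟨1, one_ne_zero, ?_⟩
    have e : pbw F q (((i, j, k), r, s, t) + single .γ) = γ F q * pbw F q ((i, j, k), r, s, t) := by
      simp only [pbw, single, Prod.mk_add_mk, add_zero, pow_succ, mul_assoc]
      rw [(hγ (A F q ^ i)).left_comm, (hγ (B F q ^ j)).left_comm, (hγ (C F q ^ k)).left_comm,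
        (hγ (α F q ^ r)).left_comm, (hγ (β F q ^ s)).left_comm, (hγ (γ F q ^ t)).eq]
    rw [e, one_smul, γ, sub_self]
    exact zero_mem _

theorem filt_le_span_pbw (hq : q ≠ 0) (n : ℕ) :
    filt F q n ≤ Submodule.span F (pbw F q '' {m | deg m ≤ n}) := by
  induction n with
  | zero =>
    rw [filt, pow_zero, Submodule.one_le]
    exact Submodule.subset_span ⟨0, by simp [deg], by simp [pbw]⟩
  | succ n ih =>
    have hmono : Submodule.span F (pbw F q '' {m | deg m ≤ n}) ≤
        Submodule.span F (pbw F q '' {m | deg m ≤ n + 1}) :=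
      Submodule.span_mono (Set.image_mono fun m hm => Nat.le_succ_of_le hm)
    have h1 : filt F q (n + 1) ≤ Submodule.span F (insert 1 (Set.range (gen F q))) *
        Submodule.span F (pbw F q '' {m | deg m ≤ n}) := by
      rw [filt, pow_succ']
      exact mul_le_mul_right ih _
    refine h1.trans ?_
    rw [Submodule.span_mul_span, Submodule.span_le]
    rintro _ ⟨x, hx, _, ⟨m, hm, rfl⟩, rfl⟩
    rcases hx with rfl | ⟨g, rfl⟩
    · simpa using hmono (Submodule.subset_span ⟨m, hm, rfl⟩)
    · obtain ⟨c, -, hc⟩ := gen_mul_pbw hq g m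
      have h2 := hmono (ih (filt_mono hm hc))
      have h3 : c • pbw F q (m + single g) ∈
          Submodule.span F (pbw F q '' {m | deg m ≤ n + 1}) :=
        Submodule.smul_mem _ _ (Submodule.subset_span ⟨_, by
          rw [Set.mem_ofPred_eq, deg_add, deg_single]
          exact Nat.succ_le_succ hm, rfl⟩)
      simpa using add_mem h2 h3

theorem exists_mem_filt (z : UAW F q) : ∃ n, z ∈ filt F q n := by
  have h : z ∈ Algebra.adjoin F (Set.range (gen F q)) := by
    rw [adjoin_range_gen]
    trivial
  induction h using Algebra.adjoin_induction with
  | mem x hx =>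
    obtain ⟨g, rfl⟩ := hx
    exact ⟨1, gen_mem_filt g⟩
  | algebraMap r =>
    refine ⟨0, ?_⟩
    rw [Algebra.algebraMap_eq_smul_one]
    exact Submodule.smul_mem _ _ one_mem_filt_zero
  | add x y _ _ hx hy =>
    obtain ⟨m, hm⟩ := hx
    obtain ⟨n, hn⟩ := hy
    exact ⟨max m n, add_mem (filt_mono (le_max_left m n) hm) (filt_mono (le_max_right m n) hn)⟩
  | mul x y _ _ hx hy =>
    obtain ⟨m, hm⟩ := hx
    obtain ⟨n, hn⟩ := hy
    exact ⟨m + n, mul_mem_filt hm hn⟩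

/-- The basis of ordered monomials. -/
noncomputable def pbwBasis (hq : q ≠ 0) :
    Module.Basis ((ℕ × ℕ × ℕ) × (ℕ × ℕ × ℕ)) F (UAW F q) :=
  Module.Basis.mk (linearIndependent_pbw hq) fun z _ => by
    obtain ⟨n, hn⟩ := exists_mem_filt z
    exact Submodule.span_mono (Set.image_subset_range _ _) (filt_le_span_pbw hq n hn)

theorem pbwBasis_apply (hq : q ≠ 0) (m : (ℕ × ℕ × ℕ) × (ℕ × ℕ × ℕ)) :
    pbwBasis hq m = pbw F q m := Module.Basis.mk_apply _ _ m

/-- The ordered monomials are a basis compatible with the filtration, so lower terms can be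
discarded by reading coordinates. -/
theorem repr_eq_zero_of_mem_filtLT (hq : q ≠ 0) {n : ℕ} {z : UAW F q} (hz : z ∈ filtLT F q n)
    {m : (ℕ × ℕ × ℕ) × (ℕ × ℕ × ℕ)} (hm : n ≤ deg m) : (pbwBasis hq).repr z m = 0 := by
  cases n with
  | zero =>
    rw [filtLT, Submodule.mem_bot] at hz
    simp [hz]
  | succ n =>
    have h := filt_le_span_pbw hq n hz
    have e : pbw F q = pbwBasis hq := funext fun m => (pbwBasis_apply hq m).symm
    rw [e, Module.Basis.mem_span_image] at h
    by_contra hne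
    have := h (Finsupp.mem_support_iff.2 hne)
    rw [Set.mem_ofPred_eq] at this
    omega

end Filtration

end UAW

namespace UAW

/-! ### Leading exponents and top-degree terms. -/

section Leading

variable {F : Type*} [Field F] {q : F}

/-- `y` is a nonzero multiple of the ordered monomial with exponents `m`, up to lower terms. -/
def HasLead (y : UAW F q) (m : (ℕ × ℕ × ℕ) × (ℕ × ℕ × ℕ)) : Prop :=
  ∃ c : F, c ≠ 0 ∧ y - c • pbw F q m ∈ filtLT F q (deg m)

theorem HasLead.mem_filt {y : UAW F q} {m : (ℕ × ℕ × ℕ) × (ℕ × ℕ × ℕ)} (h : HasLead y m) :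
    y ∈ filt F q (deg m) := by
  obtain ⟨c, -, hc⟩ := h
  simpa using add_mem (filtLT_le _ hc) (Submodule.smul_mem _ c (pbw_mem_filt m))

theorem hasLead_one : HasLead (1 : UAW F q) 0 :=
  ⟨1, one_ne_zero, by simp [pbw]⟩

/-- Left multiplication by `x` shifts leading exponents by `s`. -/
def IsShift (x : UAW F q) (s : (ℕ × ℕ × ℕ) × (ℕ × ℕ × ℕ)) : Prop :=
  ∀ y m, HasLead y m → HasLead (x * y) (m + s)

theorem isShift_gen (hq : q ≠ 0) (g : UAWGen) : IsShift (gen F q g) (single g) := by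
  rintro y m ⟨c, hc, hy⟩
  obtain ⟨b, hb, h⟩ := gen_mul_pbw hq g m
  refine ⟨c * b, mul_ne_zero hc hb, ?_⟩
  have e : gen F q g * y - (c * b) • pbw F q (m + single g) =
      gen F q g * (y - c • pbw F q m)
        + c • (gen F q g * pbw F q m - b • pbw F q (m + single g)) := by
    rw [mul_sub, smul_sub, smul_smul, mul_smul_comm]
    abel
  rw [e, deg_add, deg_single]
  refine add_mem ?_ (Submodule.smul_mem _ _ h)
  rw [add_comm]
  exact mul_mem_filtLT_right (gen_mem_filt g) hy

theorem isShift_one : IsShift (1 : UAW F q) 0 := fun y m h => by simpa using h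

theorem IsShift.mul {x x' : UAW F q} {s s' : (ℕ × ℕ × ℕ) × (ℕ × ℕ × ℕ)} (h : IsShift x s)
    (h' : IsShift x' s') : IsShift (x * x') (s + s') := fun y m hy => by
  rw [mul_assoc, add_comm s, ← add_assoc]
  exact h _ _ (h' _ _ hy)

theorem IsShift.pow {x : UAW F q} {s : (ℕ × ℕ × ℕ) × (ℕ × ℕ × ℕ)} (h : IsShift x s) (n : ℕ) :
    IsShift (x ^ n) (n • s) := by
  induction n with
  | zero => simpa using isShift_one
  | succ n ih =>
    rw [pow_succ, succ_nsmul]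
    exact ih.mul h

theorem IsShift.smul {x : UAW F q} {s : (ℕ × ℕ × ℕ) × (ℕ × ℕ × ℕ)} (h : IsShift x s) {a : F}
    (ha : a ≠ 0) : IsShift (a • x) s := fun y m hy => by
  obtain ⟨c, hc, hy⟩ := h y m hy
  refine ⟨a * c, mul_ne_zero ha hc, ?_⟩
  rw [smul_mul_assoc, mul_smul, ← smul_sub]
  exact Submodule.smul_mem _ _ hy

theorem IsShift.congr {x x' : UAW F q} {s : (ℕ × ℕ × ℕ) × (ℕ × ℕ × ℕ)} (h : IsShift x s)
    (hx : x' - x ∈ filtLT F q (deg s)) : IsShift x' s := fun y m hy => by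
  obtain ⟨c, hc, h'⟩ := h y m hy
  refine ⟨c, hc, ?_⟩
  have e : x' * y - c • pbw F q (m + s) = (x' - x) * y + (x * y - c • pbw F q (m + s)) := by
    rw [sub_mul]
    abel
  rw [e]
  refine add_mem ?_ h'
  rw [deg_add, add_comm]
  exact mul_mem_filtLT_left hx hy.mem_filt

/-- The two claims are carried together by the three-term recurrence. Monicity starts at index 1,
since T_0 is 2 rather than 1. -/
theorem T_sub_pow_mem_filt {x : UAW F q} (hx : x ∈ filt F q 1) (n : ℕ) :
    T F q n x ∈ filt F q n ∧ T F q (n + 1) x - x ^ (n + 1) ∈ filt F q n := by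
  induction n with
  | zero =>
    constructor
    · have h : T F q 0 x = 1 + 1 := by
        rw [T, Nat.cast_zero, Polynomial.Chebyshev.C_zero,
          ← one_add_one_eq_two (R := Polynomial F), map_add, map_one]
      rw [h]
      exact add_mem one_mem_filt_zero one_mem_filt_zero
    · simp [T]
  | succ n ih =>
    constructor
    · have h := pow_mem_filt hx (n + 1)
      rw [mul_one] at h
      simpa using add_mem (filt_mono n.le_succ ih.2) h
    · have h : T F q (n + 1 + 1) x = x * T F q (n + 1) x - T F q n x := by
        simp only [T]
        push_cast
        rw [add_assoc, one_add_one_eq_two, Polynomial.Chebyshev.C_add_two, map_sub, map_mul,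
          Polynomial.aeval_X]
      have e : T F q (n + 1 + 1) x - x ^ (n + 1 + 1) =
          x * (T F q (n + 1) x - x ^ (n + 1)) - T F q n x := by
        rw [h, mul_sub, ← pow_succ']
        abel
      rw [e]
      refine sub_mem ?_ (filt_mono n.le_succ ih.1)
      have h := mul_mem_filt hx ih.2
      rwa [add_comm 1 n] at h

theorem deg_nsmul (n : ℕ) (m : (ℕ × ℕ × ℕ) × (ℕ × ℕ × ℕ)) : deg (n • m) = n * deg m := by
  simp only [deg, Prod.smul_fst, Prod.smul_snd, smul_eq_mul]
  ring

theorem isShift_T (hq : q ≠ 0) {n : ℕ} (hn : 0 < n) (g : UAWGen) :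
    IsShift (T F q n (gen F q g)) (n • single g) := by
  refine ((isShift_gen hq g).pow n).congr ?_
  obtain ⟨n, rfl⟩ := Nat.exists_eq_succ_of_ne_zero hn.ne'
  rw [deg_nsmul, deg_single, mul_one]
  exact (T_sub_pow_mem_filt (gen_mem_filt g) n).2

theorem isShift_Ω (hq : q ≠ 0) : IsShift (Ω F q) ((1, 1, 1), (0, 0, 0)) := by
  have h := (((isShift_gen hq .A).mul (isShift_gen hq .B)).mul (isShift_gen hq .C)).smul
    (neg_ne_zero.2 hq)
  refine h.congr ?_
  change Ω F q - (-q) • (A F q * B F q * C F q) ∈ filt F q 2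
  have e : Ω F q - (-q) • (A F q * B F q * C F q) =
      (q ^ 2 + q⁻¹ ^ 2) • 1 - q ^ 2 • A F q ^ 2 - q⁻¹ ^ 2 • B F q ^ 2 - q ^ 2 • C F q ^ 2
        + q • (A F q * α F q) + q⁻¹ • (B F q * β F q) + q • (C F q * γ F q) := by
    rw [Ω, Algebra.algebraMap_eq_smul_one]
    module
  have h2 : ∀ g g', gen F q g * gen F q g' ∈ filt F q 2 := fun g g' =>
    mul_mem_filt (gen_mem_filt g) (gen_mem_filt g')
  rw [e]
  simp only [pow_two (A F q), pow_two (B F q), pow_two (C F q)]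
  exact add_mem (add_mem (add_mem (sub_mem (sub_mem (sub_mem
    (Submodule.smul_mem _ _ (filt_mono (Nat.zero_le 2) one_mem_filt_zero))
    (Submodule.smul_mem _ _ (h2 _ _))) (Submodule.smul_mem _ _ (h2 _ _)))
    (Submodule.smul_mem _ _ (h2 _ _))) (Submodule.smul_mem _ _ (h2 _ _)))
    (Submodule.smul_mem _ _ (h2 _ _))) (Submodule.smul_mem _ _ (h2 _ _))

theorem hasLead_monomial (hq : q ≠ 0) {n : ℕ} (hn : 0 < n) (i₀ i₁ i₂ j₀ j₁ j₂ ℓ : ℕ) :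
    HasLead (monomial F q n i₀ i₁ i₂ j₀ j₁ j₂ ℓ)
      ((n * i₀ + ℓ, n * i₁ + ℓ, n * i₂ + ℓ), (j₀, j₁, j₂)) := by
  have h := ((((((((isShift_T hq hn .A).pow i₀).mul ((isShift_T hq hn .B).pow i₁)).mul
    ((isShift_T hq hn .C).pow i₂)).mul ((isShift_gen hq .α).pow j₀)).mul
    ((isShift_gen hq .β).pow j₁)).mul ((isShift_gen hq .γ).pow j₂)).mul
    ((isShift_Ω hq).pow ℓ)) 1 0 hasLead_one
  rw [mul_one] at h
  have e : (((n * i₀ + ℓ, n * i₁ + ℓ, n * i₂ + ℓ), (j₀, j₁, j₂)) :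
      (ℕ × ℕ × ℕ) × (ℕ × ℕ × ℕ)) = 0 + (i₀ • n • single .A + i₁ • n • single .B
        + i₂ • n • single .C + j₀ • single .α + j₁ • single .β + j₂ • single .γ
        + ℓ • ((1, 1, 1), (0, 0, 0))) := by
    simp [single, mul_comm n]
  rw [e]
  exact h

/-- In a relation, take a term of maximal degree. At its leading exponent every other term has
coordinate zero: its own leading exponent differs, and its remaining monomials have lower degree. -/
theorem linearIndependent_of_hasLead (hq : q ≠ 0) {ι : Type*} {u : ι → UAW F q}
    {e : ι → (ℕ × ℕ × ℕ) × (ℕ × ℕ × ℕ)} (he : Function.Injective e)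
    (hu : ∀ i, HasLead (u i) (e i)) : LinearIndependent F u := by
  rw [linearIndependent_iff]
  intro l hl
  by_contra hne
  obtain ⟨i, hi, hmax⟩ := Finset.exists_max_image l.support (fun i => deg (e i))
    (Finsupp.support_nonempty_iff.2 hne)
  have hrepr : ∀ k ∈ l.support, k ≠ i → (pbwBasis hq).repr (u k) (e i) = 0 := by
    intro k hk hki
    obtain ⟨c, -, hc⟩ := hu k
    have h := repr_eq_zero_of_mem_filtLT hq hc (hmax k hk)
    rw [map_sub, map_smul, ← pbwBasis_apply hq, Module.Basis.repr_self] at h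
    simpa [Finsupp.single_apply, he.ne hki, sub_eq_zero] using h
  obtain ⟨c, hc0, hc⟩ := hu i
  have h := repr_eq_zero_of_mem_filtLT hq hc le_rfl
  rw [map_sub, map_smul, ← pbwBasis_apply hq, Module.Basis.repr_self] at h
  have h' : (pbwBasis hq).repr (u i) (e i) = c := by simpa [sub_eq_zero] using h
  have hsum := congrArg (fun z => (pbwBasis hq).repr z (e i)) hl
  simp only [Finsupp.linearCombination_apply, Finsupp.sum, map_sum, map_smul,
    Finsupp.finsetSum_apply, Finsupp.smul_apply, map_zero, Finsupp.zero_apply] at hsum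
  rw [Finset.sum_eq_single i (fun k hk hki => by rw [hrepr k hk hki, smul_zero])
    (fun h => absurd hi h), h', smul_eq_mul] at hsum
  exact mul_ne_zero (Finsupp.mem_support_iff.1 hi) hc0 hsum

/-- A top-degree exponent of an element commuting with a generator `g` satisfies the
commutation condition with `g`. -/
theorem eq_one_of_commute (hq : q ≠ 0) {g : UAWGen} {c : (ℕ × ℕ × ℕ) × (ℕ × ℕ × ℕ) → F}
    (hc : ∀ m, QCommute (deg m) 1 (pbw F q m) (gen F q g) (c m)) {n : ℕ} {z : UAW F q}
    (hz : z ∈ filt F q n) (hcomm : Commute z (gen F q g)) {m : (ℕ × ℕ × ℕ) × (ℕ × ℕ × ℕ)}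
    (hm : deg m = n) (hzm : (pbwBasis hq).repr z m ≠ 0) : c m = 1 := by
  have hdeg : ∀ k, n < deg k → (pbwBasis hq).repr z k = 0 := fun k hk =>
    repr_eq_zero_of_mem_filtLT hq (n := n + 1) hz hk
  -- In the commutator [z, g], the coordinate at `m + single g` sees only the leading parts of the
  -- commutators with monomials of z, and among those only k = m.
  have hterm : ∀ k, deg k ≤ n → ∃ b : F, b ≠ 0 ∧ (pbwBasis hq).repr
      (pbw F q k * gen F q g - gen F q g * pbw F q k) (m + single g) =
      if k = m then (c k - 1) * b else 0 := by
    intro k hk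
    obtain ⟨b, hb, h1⟩ := gen_mul_pbw hq g k
    refine ⟨b, hb, ?_⟩
    have e : pbw F q k * gen F q g - gen F q g * pbw F q k =
        (pbw F q k * gen F q g - c k • (gen F q g * pbw F q k))
        + (c k - 1) • (gen F q g * pbw F q k - b • pbw F q (k + single g))
        + ((c k - 1) * b) • pbw F q (k + single g) := by
      module
    have hle : deg k + 1 ≤ deg (m + single g) := by
      rw [deg_add, deg_single]
      omega
    rw [e, map_add (pbwBasis hq).repr, map_add (pbwBasis hq).repr, map_smul, map_smul,
      Finsupp.add_apply, Finsupp.add_apply,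
      Finsupp.smul_apply, repr_eq_zero_of_mem_filtLT hq (hc k).3 hle,
      repr_eq_zero_of_mem_filtLT hq h1 hle, ← pbwBasis_apply hq, Module.Basis.repr_self]
    by_cases hkm : k = m <;> simp [hkm]
  choose! b hb hb' using hterm
  have hsum : z = ∑ k ∈ ((pbwBasis hq).repr z).support, (pbwBasis hq).repr z k • pbw F q k := by
    conv_lhs => rw [← (pbwBasis hq).linearCombination_repr z]
    simp only [Finsupp.linearCombination_apply, Finsupp.sum, pbwBasis_apply]
  have h0 : z * gen F q g - gen F q g * z = ∑ k ∈ ((pbwBasis hq).repr z).support,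
      (pbwBasis hq).repr z k • (pbw F q k * gen F q g - gen F q g * pbw F q k) := by
    conv_lhs => rw [hsum]
    simp only [Finset.sum_mul, Finset.mul_sum, ← Finset.sum_sub_distrib, smul_mul_assoc,
      mul_smul_comm, smul_sub]
  rw [hcomm.eq, sub_self] at h0
  have h1 := congrArg (fun y => (pbwBasis hq).repr y (m + single g)) h0
  simp only [map_sum, map_smul, Finsupp.finsetSum_apply, Finsupp.smul_apply, map_zero,
    Finsupp.zero_apply] at h1
  have hms : m ∈ ((pbwBasis hq).repr z).support := Finsupp.mem_support_iff.2 hzm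
  have hle : ∀ k ∈ ((pbwBasis hq).repr z).support, deg k ≤ n := fun k hk => by
    by_contra hlt
    exact Finsupp.mem_support_iff.1 hk (hdeg k (not_le.1 hlt))
  rw [Finset.sum_eq_single m (fun k hk hkm => by rw [hb' k (hle k hk), if_neg hkm, smul_zero])
    (fun h => absurd hms h), hb' m hm.le, if_pos rfl, smul_eq_mul] at h1
  have h2 := (mul_eq_zero.1 h1.symm).resolve_left hzm
  exact sub_eq_zero.1 ((mul_eq_zero.1 h2).resolve_right (hb m hm.le))

end Leading

/-! ### Determination of the center and integrality. -/

section Center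

variable {F : Type*} [Field F] {q : F}

theorem modEq_of_pow_eq {d : ℕ} (hq : IsPrimitiveRoot q d) (h0 : q ≠ 0) {i j : ℕ}
    (h : (q ^ 2) ^ i = (q ^ 2) ^ j) : i ≡ j [MOD dbar d] := by
  have : IsPrimitiveRoot (q ^ 2) (dbar d) :=
    ⟨by rw [← pow_mul, dbar_dvd_iff hq], fun l hl => by rwa [← pow_mul, dbar_dvd_iff hq] at hl⟩
  have hu : Units.mk0 (q ^ 2) (pow_ne_zero 2 h0) ^ i = Units.mk0 (q ^ 2) (pow_ne_zero 2 h0) ^ j :=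
    Units.ext (by simpa using h)
  rw [pow_eq_pow_iff_modEq, ← orderOf_units, Units.val_mk0, ← this.eq_orderOf] at hu
  exact hu

/-- The exponents of a top-degree term of a central element are congruent. -/
theorem modEq_of_mem_center {d : ℕ} (hq : IsPrimitiveRoot q d) (h0 : q ≠ 0) {n : ℕ}
    {z : UAW F q} (hz : z ∈ filt F q n) (hc : z ∈ Subalgebra.center F (UAW F q))
    {m : (ℕ × ℕ × ℕ) × (ℕ × ℕ × ℕ)} (hm : deg m = n) (hzm : (pbwBasis h0).repr z m ≠ 0) :
    m.1.1 ≡ m.1.2.2 [MOD dbar d] ∧ m.1.2.1 ≡ m.1.2.2 [MOD dbar d] := by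
  have hself : ∀ g, QCommute 1 1 (gen F q g) (gen F q g) 1 := fun g =>
    QCommute.of_commute (gen_mem_filt g) (gen_mem_filt g) rfl
  -- Commuting with A yields q^(2j) = q^(2k), and commuting with B yields q^(2i) = q^(2k); commuting
  -- with C would add nothing.
  have hA := eq_one_of_commute h0 (g := .A)
    (qCommute_pbw (hself .A) qCommute_B_A qCommute_C_A) hz (commute_of_mem_center hc _) hm hzm
  have hB := eq_one_of_commute h0 (g := .B)
    (qCommute_pbw (qCommute_B_A.symm (pow_ne_zero 2 h0)) (hself .B) qCommute_C_B) hz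
    (commute_of_mem_center hc _) hm hzm
  have hne : q ^ 2 ≠ 0 := pow_ne_zero 2 h0
  constructor
  · refine modEq_of_pow_eq hq h0 ?_
    rw [one_pow, mul_one, inv_pow] at hB
    field_simp at hB
    exact hB.symm
  · refine modEq_of_pow_eq hq h0 ?_
    rw [one_pow, one_mul, inv_pow, inv_pow] at hA
    field_simp at hA
    exact hA

/-- A family of central elements whose leading exponents exhaust the exponents congruent modulo
`dbar d` spans the center. -/
theorem mem_span_of_mem_center {d : ℕ} (hq : IsPrimitiveRoot q d) (h0 : q ≠ 0) {ι : Type*}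
    {u : ι → UAW F q} (hu : ∀ i, u i ∈ Subalgebra.center F (UAW F q))
    (hlead : ∀ m : (ℕ × ℕ × ℕ) × (ℕ × ℕ × ℕ), m.1.1 ≡ m.1.2.2 [MOD dbar d] →
      m.1.2.1 ≡ m.1.2.2 [MOD dbar d] → ∃ i, HasLead (u i) m) {z : UAW F q}
    (hz : z ∈ Subalgebra.center F (UAW F q)) : z ∈ Submodule.span F (Set.range u) := by
  have hspan : Submodule.span F (Set.range u) ≤
      Subalgebra.toSubmodule (Subalgebra.center F (UAW F q)) := by
    rw [Submodule.span_le]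
    rintro _ ⟨i, rfl⟩
    exact hu i
  have key : ∀ (n : ℕ) (z : UAW F q), z ∈ filtLT F q n → z ∈ Subalgebra.center F (UAW F q) →
      z ∈ Submodule.span F (Set.range u) := by
    intro n
    induction n with
    | zero =>
      intro z hz _
      rw [filtLT, Submodule.mem_bot] at hz
      rw [hz]
      exact zero_mem _
    | succ n ih =>
      intro z hz hc
      -- Each top-degree monomial of z is replaced by a multiple of some `u i`; monomials of lower
      -- degree are left alone with w = 0. The difference is central and of lower degree, so the
      -- induction applies.
      have hw : ∀ m, ∃ w ∈ Submodule.span F (Set.range u),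
          (pbwBasis h0).repr z m • pbw F q m - w ∈ filtLT F q n := by
        intro m
        by_cases hzm : (pbwBasis h0).repr z m = 0
        · exact ⟨0, zero_mem _, by simp [hzm]⟩
        have hm : deg m ≤ n := by
          by_contra hlt
          exact hzm (repr_eq_zero_of_mem_filtLT h0 hz (not_le.1 hlt))
        rcases hm.lt_or_eq with hm | hm
        · refine ⟨0, zero_mem _, ?_⟩
          rw [sub_zero]
          exact Submodule.smul_mem _ _ (filt_le_filtLT hm (pbw_mem_filt m))
        · obtain ⟨h1, h2⟩ := modEq_of_mem_center hq h0 hz hc hm hzm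
          obtain ⟨i, c, hc0, hi⟩ := hlead m h1 h2
          refine ⟨((pbwBasis h0).repr z m * c⁻¹) • u i,
            Submodule.smul_mem _ _ (Submodule.subset_span ⟨i, rfl⟩), ?_⟩
          have e : (pbwBasis h0).repr z m • pbw F q m - ((pbwBasis h0).repr z m * c⁻¹) • u i =
              (-((pbwBasis h0).repr z m * c⁻¹)) • (u i - c • pbw F q m) := by
            match_scalars <;> field_simp
          rw [e, ← hm]
          exact Submodule.smul_mem _ _ hi
      choose w hw1 hw2 using hw
      have hsum : z = ∑ k ∈ ((pbwBasis h0).repr z).support,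
          (pbwBasis h0).repr z k • pbw F q k := by
        conv_lhs => rw [← (pbwBasis h0).linearCombination_repr z]
        simp only [Finsupp.linearCombination_apply, Finsupp.sum, pbwBasis_apply]
      have hw3 : ∑ k ∈ ((pbwBasis h0).repr z).support, w k ∈ Submodule.span F (Set.range u) :=
        sum_mem fun k _ => hw1 k
      have h1 : z - ∑ k ∈ ((pbwBasis h0).repr z).support, w k ∈ filtLT F q n := by
        have h := sum_mem (t := ((pbwBasis h0).repr z).support) fun k _ => hw2 k
        rwa [Finset.sum_sub_distrib, ← hsum] at h
      have h2 := ih _ h1 (sub_mem hc (hspan hw3))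
      simpa using add_mem h2 hw3
  obtain ⟨n, hn⟩ := exists_mem_filt z
  exact key (n + 1) z hn hz

theorem monomial_mem_center {d : ℕ} (hd : 0 < d) (hq : IsPrimitiveRoot q d)
    (i₀ i₁ i₂ j₀ j₁ j₂ ℓ : ℕ) :
    monomial F q (dbar d) i₀ i₁ i₂ j₀ j₁ j₂ ℓ ∈ Subalgebra.center F (UAW F q) := by
  obtain ⟨hA, hB, hC⟩ := T_dbar_mem_center hd hq
  exact mul_mem (mul_mem (mul_mem (mul_mem (mul_mem (mul_mem (pow_mem hA _) (pow_mem hB _))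
    (pow_mem hC _)) (pow_mem (α_mem_center F q) _)) (pow_mem (β_mem_center F q) _))
    (pow_mem (γ_mem_center F q) _)) (pow_mem (Ω_mem_center (hq.ne_zero hd.ne')) _)

/-- The family of central monomials. -/
noncomputable def centralMonomial {d : ℕ} (hd : 0 < d) (hq : IsPrimitiveRoot q d)
    (τ : (ℕ × ℕ × ℕ) × (ℕ × ℕ × ℕ) × Fin (dbar d)) : Subalgebra.center F (UAW F q) :=
  ⟨monomial F q (dbar d) τ.1.1 τ.1.2.1 τ.1.2.2 τ.2.1.1 τ.2.1.2.1 τ.2.1.2.2 τ.2.2,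
    monomial_mem_center hd hq _ _ _ _ _ _ _⟩

theorem linearIndependent_centralMonomial {d : ℕ} (hd : 0 < d) (hq : IsPrimitiveRoot q d) :
    LinearIndependent F (centralMonomial hd hq) := by
  have h0 := hq.ne_zero hd.ne'
  have hpos := dbar_pos hd
  refine LinearIndependent.of_comp (Subalgebra.center F (UAW F q)).val.toLinearMap ?_
  refine linearIndependent_of_hasLead h0 (e := fun τ => ((dbar d * τ.1.1 + τ.2.2,
    dbar d * τ.1.2.1 + τ.2.2, dbar d * τ.1.2.2 + τ.2.2), τ.2.1)) ?_
    fun τ => hasLead_monomial h0 hpos _ _ _ _ _ _ _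
  rintro ⟨⟨a, b, c⟩, j, l⟩ ⟨⟨a', b', c'⟩, j', l'⟩ h
  simp only [Prod.mk.injEq] at h
  obtain ⟨⟨h1, h2, h3⟩, rfl⟩ := h
  -- As ℓ < ħ, it is recovered as the residue of the first exponent.
  have hl : (l : ℕ) = l' := by
    have := congrArg (· % dbar d) h1
    simpa [Nat.mod_eq_of_lt l.2, Nat.mod_eq_of_lt l'.2] using this
  rw [hl] at h1 h2 h3
  have e1 := Nat.eq_of_mul_eq_mul_left hpos (Nat.add_right_cancel h1)
  have e2 := Nat.eq_of_mul_eq_mul_left hpos (Nat.add_right_cancel h2)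
  have e3 := Nat.eq_of_mul_eq_mul_left hpos (Nat.add_right_cancel h3)
  rw [e1, e2, e3, Fin.ext hl]

theorem span_centralMonomial {d : ℕ} (hd : 0 < d) (hq : IsPrimitiveRoot q d) :
    ⊤ ≤ Submodule.span F (Set.range (centralMonomial hd hq)) := by
  have h0 := hq.ne_zero hd.ne'
  have hpos := dbar_pos hd
  rintro ⟨z, hz⟩ -
  have h := mem_span_of_mem_center hq h0 (u := fun τ => (centralMonomial hd hq τ : UAW F q))
    (fun τ => (centralMonomial hd hq τ).2) (fun m h1 h2 => by
      -- The exponent ℓ of Ω is the common residue of the three exponents, and the quotients are the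
      -- powers of the Chebyshev elements.
      refine ⟨((m.1.1 / dbar d, m.1.2.1 / dbar d, m.1.2.2 / dbar d), m.2,
        ⟨m.1.2.2 % dbar d, Nat.mod_lt _ hpos⟩), ?_⟩
      have h := hasLead_monomial h0 hpos (m.1.1 / dbar d) (m.1.2.1 / dbar d) (m.1.2.2 / dbar d)
        m.2.1 m.2.2.1 m.2.2.2 (m.1.2.2 % dbar d)
      have e1 : m.1.2.2 % dbar d = m.1.1 % dbar d := h1.symm
      have e2 : m.1.2.2 % dbar d = m.1.2.1 % dbar d := h2.symm
      rw [show dbar d * (m.1.1 / dbar d) + m.1.2.2 % dbar d = m.1.1 by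
          rw [e1]; exact Nat.div_add_mod _ _,
        show dbar d * (m.1.2.1 / dbar d) + m.1.2.2 % dbar d = m.1.2.1 by
          rw [e2]; exact Nat.div_add_mod _ _, Nat.div_add_mod] at h
      exact h) hz
  have e : (Set.range fun τ => (centralMonomial hd hq τ : UAW F q)) =
      (Subalgebra.center F (UAW F q)).val.toLinearMap '' Set.range (centralMonomial hd hq) := by
    rw [← Set.range_comp]
    rfl
  rw [e, Submodule.span_image] at h
  obtain ⟨y, hy, hyz⟩ := h
  have : y = ⟨z, hz⟩ := Subtype.ext hyz
  rwa [← this]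

theorem isIntegral_center {d : ℕ} (hd : 0 < d) (hq : IsPrimitiveRoot q d) :
    Algebra.IsIntegral (centralSubalgebra F q (dbar d)) (Subalgebra.center F (UAW F q)) := by
  obtain ⟨hA, hB, hC⟩ := T_dbar_mem_center hd hq
  have h0 := hq.ne_zero hd.ne'
  have hmem : ∀ (x : UAW F q) (hx : x ∈ Subalgebra.center F (UAW F q)) (n : ℕ),
      x ∈ sixElements F q (dbar d) →
      (⟨x, hx⟩ ^ n : Subalgebra.center F (UAW F q)) ∈ centralSubalgebra F q (dbar d) :=
    fun x hx n h => pow_mem (show (⟨x, hx⟩ : Subalgebra.center F (UAW F q)) ∈ _ from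
      Algebra.subset_adjoin h) n
  let ω : Subalgebra.center F (UAW F q) := ⟨Ω F q, Ω_mem_center h0⟩
  -- Every basis element is a product of the six generators times Ω^ℓ, so the finitely many powers
  -- of Ω with ℓ < ħ generate the center as a module.
  have hfin : Module.Finite (centralSubalgebra F q (dbar d)) (Subalgebra.center F (UAW F q)) := by
    refine ⟨Submodule.fg_def.2 ⟨Set.range fun l : Fin (dbar d) => ω ^ (l : ℕ),
      Set.finite_range _, eq_top_iff.2 ?_⟩⟩
    have hle : Submodule.span F (Set.range (centralMonomial hd hq)) ≤
        (Submodule.span (centralSubalgebra F q (dbar d))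
          (Set.range fun l : Fin (dbar d) => ω ^ (l : ℕ))).restrictScalars F := by
      rw [Submodule.span_le]
      rintro _ ⟨⟨⟨i₀, i₁, i₂⟩, ⟨j₀, j₁, j₂⟩, l⟩, rfl⟩
      have hr := mul_mem (mul_mem (mul_mem (mul_mem (mul_mem
        (hmem _ hA i₀ (by simp [sixElements])) (hmem _ hB i₁ (by simp [sixElements])))
        (hmem _ hC i₂ (by simp [sixElements])))
        (hmem _ (α_mem_center F q) j₀ (by simp [sixElements])))
        (hmem _ (β_mem_center F q) j₁ (by simp [sixElements])))
        (hmem _ (γ_mem_center F q) j₂ (by simp [sixElements]))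
      exact Submodule.smul_mem _ (⟨_, hr⟩ : centralSubalgebra F q (dbar d))
        (Submodule.subset_span (Set.mem_range_self l))
    exact fun z hz => hle (span_centralMonomial hd hq hz)
  exact Algebra.IsIntegral.of_finite _ _

end Center

end UAW

theorem mainTheorem9 (F : Type*) [Field F] (d : ℕ) (hd : 0 < d) (q : F)
    (hq : IsPrimitiveRoot q d) :
    (∃ b : Module.Basis ((ℕ × ℕ × ℕ) × (ℕ × ℕ × ℕ) × Fin (UAW.dbar d)) F
        (Subalgebra.center F (UAW F q)),
      ∀ (i₀ i₁ i₂ j₀ j₁ j₂ : ℕ) (ℓ : Fin (UAW.dbar d)),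
        (b ((i₀, i₁, i₂), (j₀, j₁, j₂), ℓ) : UAW F q) =
          UAW.monomial F q (UAW.dbar d) i₀ i₁ i₂ j₀ j₁ j₂ ℓ) ∧
    UAW.sixElements F q (UAW.dbar d) ⊆ Subalgebra.center F (UAW F q) ∧
    Algebra.IsIntegral (UAW.centralSubalgebra F q (UAW.dbar d))
      (Subalgebra.center F (UAW F q)) := by
  refine ⟨⟨Module.Basis.mk (UAW.linearIndependent_centralMonomial hd hq)
    (UAW.span_centralMonomial hd hq), fun i₀ i₁ i₂ j₀ j₁ j₂ ℓ => ?_⟩, ?_,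
    UAW.isIntegral_center hd hq⟩
  · rw [Module.Basis.mk_apply]
    rfl
  · obtain ⟨hA, hB, hC⟩ := UAW.T_dbar_mem_center hd hq
    rintro x (rfl | rfl | rfl | rfl | rfl | rfl)
    exacts [hA, hB, hC, UAW.α_mem_center F q, UAW.β_mem_center F q, UAW.γ_mem_center F q]
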